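/- Let $(\Omega,\mathcal F,P)$ be a complete probability space carrying a standard real Brownian motion $W$, let $(\mathcal F_t)$ be its natural filtration, augmented by the $P$-null sets and made right-continuous, let $\Theta\subset\mathbb R$ be compact and convex, and let $T\ge 0$. Let $\mathcal A^\Theta$ be the set of progressively measurable $\Theta$-valued processes $\theta$ with $E_P\int_0^{t}|\theta_s|^2ds<\infty$ for all $t$, and for $\theta\in\mathcal A^\Theta$ let $B^\theta_t=\int_0^t\theta_s\,dW_s$ (continuous version of the Itô integral). Let $B$ be the canonical process on the space $\Omega^*$ of continuous paths $[0,\infty)\to\mathbb R$ started at $0$. A cylinder function is a function $\xi=\varphi(B_{t_1\wedge T},\dots,B_{t_n\wedge T})$ on $\Omega^*$ with $\varphi\in C_{l.Lip}(\mathbb R^n)$, i.e. $|\varphi(x)-\varphi(y)|\le C(1+|x|^m+|y|^m)|x-y|$ for some $C,m$; put $\xi^\theta=\xi(B^\theta)=\varphi(B^\theta_{t_1\wedge T},\dots,B^\theta_{t_n\wedge T})$. Let $\hat E[Z]=\sup_{\theta\in\mathcal A^\Theta}E_P[Z(B^\theta)]$ be the $G$-expectation (of nonnegative functionals $Z$).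 For $q>0$ let $L_G^q(\Omega_T)$ be the completion of the set of cylinder functions under $\|\xi\|_{L_G^q}=\hat E[|\xi|^q]^{1/q}$ (for $q<1$: under the metric $\hat E[|\xi-\eta|^q]$). Families $\{X^\theta\}_{\theta\in\mathcal A^\Theta}$ of $P$-a.s. classes of real random variables carry the topology of $L^q(P)$-convergence uniform in $\theta$. **Theorem (Preservation of multiplication).** 1. For every $q>0$: $\|\xi\|_{L^q_G}<\infty$ for all cylinder functions $\xi$; the map $\Phi(\xi)=\{\xi^\theta\}_\theta$ extends by continuity to a continuous map $\Phi:X\mapsto\{X^\theta\}_\theta$ on $L_G^q(\Omega_T)$; and $\sup_\theta E_P[|X^\theta|^q]<\infty$ for all $X\in L_G^q(\Omega_T)$. 2. Let $p>0$ (in particular, any $p\ge1$). The pointwise product of cylinder functions extends by continuity to a continuous product $L_G^p(\Omega_T)\times L_G^p(\Omega_T)\to L_G^{p/2}(\Omega_T)$, $(X,Y)\mapsto X\cdot Y$, and for all $X,Y\in L_G^p(\Omega_T)$ $$\Phi(X\cdot Y)=\Phi(X)\cdot\Phi(Y),\qquad\text{i.e. } (X\cdot Y)^\theta=X^\theta\,Y^\theta\quad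 P\text{-a.s. for every }\theta\in\mathcal A^\Theta .$$ Moreover, if cylinder functions $\xi_n\to X$ and $\eta_n\to Y$ in $L_G^p(\Omega_T)$, then $\xi_n\eta_n\to X\cdot Y$ in $L_G^{p/2}(\Omega_T)$ and $\sup_{\theta}E_P\big[|\xi_n^\theta\eta_n^\theta-X^\theta Y^\theta|^{p/2}\big]\to0$. -/

import Mathlib

open MeasureTheory ProbabilityTheory Filter Topology
open scoped NNReal ENNReal

noncomputable section

namespace GExpectation

/-! ### The path space and the cylinder functions -/

/-- The canonical path space: continuous paths `[0, ∞) → ℝ` started at `0`. The canonical process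
(which plays the role of the `G`-Brownian motion) is `B_t(x) = x.1 t`. -/
abbrev PathSpace : Type := {x : C(ℝ≥0, ℝ) // x 0 = 0}

/-- The space `C_{l.Lip}(ℝⁿ)` of locally Lipschitz functions with polynomial growth of the local
Lipschitz constant: `|φ(x) - φ(y)| ≤ C (1 + |x|^m + |y|^m) |x - y|`. -/
def IsLocLip {n : ℕ} (φ : (Fin n → ℝ) → ℝ) : Prop :=
  ∃ (C : ℝ) (m : ℕ), ∀ x y, |φ x - φ y| ≤ C * (1 + ‖x‖ ^ m + ‖y‖ ^ m) * ‖x - y‖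

/-- `ξ` is a cylinder function `φ(B_{t₁ ∧ T}, …, B_{tₙ ∧ T})` with `φ ∈ C_{l.Lip}(ℝⁿ)`. -/
def IsCylinder (T : ℝ≥0) (ξ : PathSpace → ℝ) : Prop :=
  ∃ (n : ℕ) (t : Fin n → ℝ≥0) (φ : (Fin n → ℝ) → ℝ), IsLocLip φ ∧
    ∀ x : PathSpace, ξ x = φ (fun i => x.1 (min (t i) T))

theorem isLocLip_iff {n : ℕ} (φ : (Fin n → ℝ) → ℝ) :
    IsLocLip φ ↔ ∃ (C : ℝ) (m : ℕ), 0 ≤ C ∧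
      ∀ x y, |φ x - φ y| ≤ C * (1 + ‖x‖ + ‖y‖) ^ m * ‖x - y‖ := by
  constructor
  · rintro ⟨C, m, h⟩
    refine ⟨3 * |C|, m, by positivity, fun x y => (h x y).trans ?_⟩
    have hx := norm_nonneg x
    have hy := norm_nonneg y
    have h1 : (1 : ℝ) ≤ (1 + ‖x‖ + ‖y‖) ^ m := one_le_pow₀ (by linarith)
    have h2 : ‖x‖ ^ m ≤ (1 + ‖x‖ + ‖y‖) ^ m := pow_le_pow_left₀ hx (by linarith) m
    have h3 : ‖y‖ ^ m ≤ (1 + ‖x‖ + ‖y‖) ^ m := pow_le_pow_left₀ hy (by linarith) m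
    refine mul_le_mul_of_nonneg_right ?_ (norm_nonneg _)
    calc C * (1 + ‖x‖ ^ m + ‖y‖ ^ m) ≤ |C| * (1 + ‖x‖ ^ m + ‖y‖ ^ m) := by
          gcongr; exact le_abs_self C
      _ ≤ |C| * (3 * (1 + ‖x‖ + ‖y‖) ^ m) := by gcongr; linarith
      _ = _ := by ring
  · rintro ⟨C, m, hC, h⟩
    refine ⟨C * 3 ^ m, m, fun x y => (h x y).trans ?_⟩
    have hx := norm_nonneg x
    have hy := norm_nonneg y
    have hx' := pow_nonneg hx m
    have hy' := pow_nonneg hy m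
    have key : (1 + ‖x‖ + ‖y‖) ^ m ≤ 3 ^ m * (1 + ‖x‖ ^ m + ‖y‖ ^ m) := by
      have h0 : 1 + ‖x‖ + ‖y‖ ≤ 3 * max 1 (max ‖x‖ ‖y‖) := by
        have := le_max_left 1 (max ‖x‖ ‖y‖)
        have := (le_max_left ‖x‖ ‖y‖).trans (le_max_right 1 (max ‖x‖ ‖y‖))
        have := (le_max_right ‖x‖ ‖y‖).trans (le_max_right 1 (max ‖x‖ ‖y‖))
        linarith
      calc (1 + ‖x‖ + ‖y‖) ^ m ≤ (3 * max 1 (max ‖x‖ ‖y‖)) ^ m :=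
            pow_le_pow_left₀ (by positivity) h0 m
        _ = 3 ^ m * (max 1 (max ‖x‖ ‖y‖)) ^ m := mul_pow _ _ _
        _ ≤ _ := by
          gcongr
          rcases max_choice 1 (max ‖x‖ ‖y‖) with e | e
          · rw [e, one_pow]; linarith
          · rw [e]
            rcases max_choice ‖x‖ ‖y‖ with e' | e' <;> rw [e'] <;> linarith
    refine mul_le_mul_of_nonneg_right ?_ (norm_nonneg _)
    calc C * (1 + ‖x‖ + ‖y‖) ^ m ≤ C * (3 ^ m * (1 + ‖x‖ ^ m + ‖y‖ ^ m)) := by gcongr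
      _ = _ := by ring

theorem IsLocLip.continuous {n : ℕ} {φ : (Fin n → ℝ) → ℝ} (h : IsLocLip φ) : Continuous φ := by
  obtain ⟨C, m, h⟩ := h
  rw [continuous_iff_continuousAt]
  intro x
  rw [ContinuousAt, tendsto_iff_norm_sub_tendsto_zero]
  have hc : Continuous fun y : Fin n → ℝ => C * (1 + ‖y‖ ^ m + ‖x‖ ^ m) * ‖y - x‖ := by fun_prop
  have hl := hc.tendsto x
  rw [sub_self, norm_zero, mul_zero] at hl
  exact squeeze_zero (fun _ => norm_nonneg _) (fun y => h y x) hl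

theorem IsLocLip.comp_reindex {n k : ℕ} {φ : (Fin n → ℝ) → ℝ} (h : IsLocLip φ)
    (f : Fin n → Fin k) : IsLocLip (fun z : Fin k → ℝ => φ (fun i => z (f i))) := by
  rw [isLocLip_iff] at h ⊢
  obtain ⟨C, m, hC, h⟩ := h
  have hn : ∀ z : Fin k → ℝ, ‖(fun i => z (f i))‖ ≤ ‖z‖ := fun z =>
    (pi_norm_le_iff_of_nonneg (norm_nonneg z)).2 fun i => norm_le_pi_norm z (f i)
  refine ⟨C, m, hC, fun x y => (h _ _).trans ?_⟩
  have := hn x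
  have := hn y
  have h3 : ‖(fun i => x (f i)) - (fun i => y (f i))‖ ≤ ‖x - y‖ := hn (x - y)
  gcongr

theorem IsLocLip.const {n : ℕ} (c : ℝ) : IsLocLip (fun _ : Fin n → ℝ => c) :=
  ⟨0, 0, fun x y => by simp⟩

theorem IsLocLip.add {n : ℕ} {φ ψ : (Fin n → ℝ) → ℝ} (h : IsLocLip φ) (h' : IsLocLip ψ) :
    IsLocLip (fun z => φ z + ψ z) := by
  rw [isLocLip_iff] at *
  obtain ⟨C, m, hC, h⟩ := h
  obtain ⟨D, k, hD, h'⟩ := h'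
  refine ⟨C + D, m + k, by positivity, fun x y => ?_⟩
  have hr : (1 : ℝ) ≤ 1 + ‖x‖ + ‖y‖ := by linarith [norm_nonneg x, norm_nonneg y]
  have e1 := pow_le_pow_right₀ hr (Nat.le_add_right m k)
  have e2 := pow_le_pow_right₀ hr (Nat.le_add_left k m)
  calc |φ x + ψ x - (φ y + ψ y)| = |(φ x - φ y) + (ψ x - ψ y)| := by ring_nf
    _ ≤ |φ x - φ y| + |ψ x - ψ y| := abs_add_le _ _
    _ ≤ C * (1 + ‖x‖ + ‖y‖) ^ m * ‖x - y‖ + D * (1 + ‖x‖ + ‖y‖) ^ k * ‖x - y‖ :=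
        add_le_add (h x y) (h' x y)
    _ ≤ C * (1 + ‖x‖ + ‖y‖) ^ (m + k) * ‖x - y‖ + D * (1 + ‖x‖ + ‖y‖) ^ (m + k) * ‖x - y‖ := by
        gcongr
    _ = _ := by ring

theorem IsLocLip.growth {n : ℕ} {φ : (Fin n → ℝ) → ℝ} (h : IsLocLip φ) :
    ∃ (A : ℝ) (k : ℕ), 0 ≤ A ∧ ∀ x, |φ x| ≤ A * (1 + ‖x‖) ^ k := by
  rw [isLocLip_iff] at h
  obtain ⟨C, m, hC, h⟩ := h
  refine ⟨C + |φ 0|, m + 1, by positivity, fun x => ?_⟩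
  have hx := norm_nonneg x
  have h0 := h x 0
  simp only [norm_zero, add_zero, sub_zero] at h0
  have h1 : (1 : ℝ) ≤ (1 + ‖x‖) ^ (m + 1) := one_le_pow₀ (by linarith)
  calc |φ x| = |(φ x - φ 0) + φ 0| := by ring_nf
    _ ≤ |φ x - φ 0| + |φ 0| := abs_add_le _ _
    _ ≤ C * (1 + ‖x‖) ^ m * (1 + ‖x‖) + |φ 0| * (1 + ‖x‖) ^ (m + 1) := by
        refine add_le_add (h0.trans ?_) ?_
        · gcongr; linarith
        · exact le_mul_of_one_le_right (abs_nonneg _) h1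
    _ = _ := by ring

theorem IsLocLip.mul {n : ℕ} {φ ψ : (Fin n → ℝ) → ℝ} (h : IsLocLip φ) (h' : IsLocLip ψ) :
    IsLocLip (fun z => φ z * ψ z) := by
  obtain ⟨A, a, hA, hφ⟩ := h.growth
  obtain ⟨B, b, hB, hψ⟩ := h'.growth
  rw [isLocLip_iff] at *
  obtain ⟨C, m, hC, h⟩ := h
  obtain ⟨D, k, hD, h'⟩ := h'
  refine ⟨A * D + B * C, a + k + (b + m), by positivity, fun x y => ?_⟩
  have hx := norm_nonneg x
  have hy := norm_nonneg y
  set r : ℝ := 1 + ‖x‖ + ‖y‖ with hrdef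
  have hr : (1 : ℝ) ≤ r := by linarith
  have g1 : |φ x| ≤ A * r ^ a := (hφ x).trans (by gcongr; linarith)
  have g2 : |ψ y| ≤ B * r ^ b := (hψ y).trans (by gcongr; linarith)
  have e1 := pow_le_pow_right₀ hr (Nat.le_add_right (a + k) (b + m))
  have e2 := pow_le_pow_right₀ hr (Nat.le_add_left (b + m) (a + k))
  calc |φ x * ψ x - φ y * ψ y| = |φ x * (ψ x - ψ y) + ψ y * (φ x - φ y)| := by ring_nf
    _ ≤ |φ x * (ψ x - ψ y)| + |ψ y * (φ x - φ y)| := abs_add_le _ _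
    _ = |φ x| * |ψ x - ψ y| + |ψ y| * |φ x - φ y| := by rw [abs_mul, abs_mul]
    _ ≤ (A * r ^ a) * (D * r ^ k * ‖x - y‖) + (B * r ^ b) * (C * r ^ m * ‖x - y‖) := by
        have := h x y
        have := h' x y
        gcongr
    _ = A * D * r ^ (a + k) * ‖x - y‖ + B * C * r ^ (b + m) * ‖x - y‖ := by ring
    _ ≤ A * D * r ^ (a + k + (b + m)) * ‖x - y‖ + B * C * r ^ (a + k + (b + m)) * ‖x - y‖ := by
        gcongr
    _ = _ := by ring

theorem IsCylinder.common {T : ℝ≥0} {ξ η : PathSpace → ℝ} (h : IsCylinder T ξ)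
    (h' : IsCylinder T η) : ∃ (n : ℕ) (t : Fin n → ℝ≥0) (φ ψ : (Fin n → ℝ) → ℝ),
      IsLocLip φ ∧ IsLocLip ψ ∧ (∀ x : PathSpace, ξ x = φ (fun i => x.1 (min (t i) T))) ∧
      ∀ x : PathSpace, η x = ψ (fun i => x.1 (min (t i) T)) := by
  obtain ⟨n, t, φ, hφ, hξ⟩ := h
  obtain ⟨m, s, ψ, hψ, hη⟩ := h'
  refine ⟨n + m, Fin.append t s, _, _, hφ.comp_reindex (Fin.castAdd m),
    hψ.comp_reindex (Fin.natAdd n), fun x => ?_, fun x => ?_⟩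
  · simp [hξ]
  · simp [hη]

/-- The algebra `𝒞_T` of cylinder functions, with the pointwise operations. -/
def cylinderFunctions (T : ℝ≥0) : Subalgebra ℝ (PathSpace → ℝ) where
  carrier := {ξ | IsCylinder T ξ}
  mul_mem' := by
    intro ξ η h h'
    obtain ⟨n, t, φ, ψ, hφ, hψ, e, e'⟩ := IsCylinder.common h h'
    exact ⟨n, t, _, hφ.mul hψ, fun x => by simp [e, e']⟩
  add_mem' := by
    intro ξ η h h'
    obtain ⟨n, t, φ, ψ, hφ, hψ, e, e'⟩ := IsCylinder.common h h'
    exact ⟨n, t, _, hφ.add hψ, fun x => by simp [e, e']⟩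
  algebraMap_mem' := fun c => ⟨0, fun _ => 0, _, IsLocLip.const c, fun _ => rfl⟩

theorem iSup_lintegral_triangle {Ω : Type*} [MeasurableSpace Ω] {P : Measure Ω} {ι : Sort*}
    {p : ℝ} (hp : 0 < p) (f g : ι → Ω → ℝ)
    (hf : ∀ i, AEMeasurable (f i) P) (hg : ∀ i, AEMeasurable (g i) P) :
    (⨆ i, ∫⁻ ω, ‖f i ω + g i ω‖ₑ ^ p ∂P) ^ (min 1 p⁻¹) ≤
      (⨆ i, ∫⁻ ω, ‖f i ω‖ₑ ^ p ∂P) ^ (min 1 p⁻¹) +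
        (⨆ i, ∫⁻ ω, ‖g i ω‖ₑ ^ p ∂P) ^ (min 1 p⁻¹) := by
  rcases le_total 1 p with h | h
  · rw [min_eq_right (inv_le_one_of_one_le₀ h)]
    have hinv : 0 < p⁻¹ := inv_pos.2 hp
    rw [ENNReal.rpow_inv_le_iff hp]
    refine iSup_le fun i => ?_
    rw [← ENNReal.rpow_inv_le_iff hp]
    calc (∫⁻ ω, ‖f i ω + g i ω‖ₑ ^ p ∂P) ^ p⁻¹
        ≤ (∫⁻ ω, ((fun ω => ‖f i ω‖ₑ) + fun ω => ‖g i ω‖ₑ) ω ^ p ∂P) ^ (1 / p) := by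
          rw [one_div]
          gcongr
          exact enorm_add_le _ _
      _ ≤ (∫⁻ ω, ‖f i ω‖ₑ ^ p ∂P) ^ (1 / p) + (∫⁻ ω, ‖g i ω‖ₑ ^ p ∂P) ^ (1 / p) :=
          ENNReal.lintegral_Lp_add_le (hf i).enorm (hg i).enorm h
      _ ≤ _ := by
          rw [one_div]
          gcongr
          · exact le_iSup (fun i => ∫⁻ ω, ‖f i ω‖ₑ ^ p ∂P) i
          · exact le_iSup (fun i => ∫⁻ ω, ‖g i ω‖ₑ ^ p ∂P) i
  · rw [min_eq_left ((one_le_inv₀ hp).2 h)]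
    simp only [ENNReal.rpow_one]
    refine iSup_le fun i => ?_
    calc ∫⁻ ω, ‖f i ω + g i ω‖ₑ ^ p ∂P
        ≤ ∫⁻ ω, (‖f i ω‖ₑ ^ p + ‖g i ω‖ₑ ^ p) ∂P := by
          refine lintegral_mono fun ω => ?_
          exact (ENNReal.rpow_le_rpow (enorm_add_le _ _) hp.le).trans
            (ENNReal.rpow_add_le_add_rpow _ _ hp.le h)
      _ = ∫⁻ ω, ‖f i ω‖ₑ ^ p ∂P + ∫⁻ ω, ‖g i ω‖ₑ ^ p ∂P :=
          lintegral_add_left' ((hf i).enorm.pow_const p) _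
      _ ≤ _ := add_le_add (le_iSup (fun i => ∫⁻ ω, ‖f i ω‖ₑ ^ p ∂P) i)
          (le_iSup (fun i => ∫⁻ ω, ‖g i ω‖ₑ ^ p ∂P) i)

/-! ### The augmented Brownian filtration, the Itô integral and the controls -/

variable {Ω : Type*} [mΩ : MeasurableSpace Ω] {P : Measure Ω} [P.IsComplete] {W : ℝ≥0 → Ω → ℝ}

theorem measurable_of_isBrownian (hW : IsBrownianReal W P) (t : ℝ≥0) : Measurable (W t) :=
  (hW.aemeasurable t).nullMeasurable.measurable_of_complete

/-- The natural filtration of `W`, augmented by all `P`-null sets and made right-continuous: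
`ℱ_t = ⋂_{s > t} (σ(W_u, u ≤ s) ∨ 𝒩)`. -/
def brownianFiltration (hW : IsBrownianReal W P) : Filtration ℝ≥0 mΩ where
  seq t := ⨅ s > t, (⨆ u ≤ s, MeasurableSpace.comap (W u) inferInstance) ⊔
    MeasurableSpace.generateFrom {A | P A = 0}
  mono' _ _ hij := le_iInf₂ fun s hs => iInf₂_le s (lt_of_le_of_lt hij hs)
  le' t := iInf₂_le_of_le (t + 1) (lt_add_one t) <| sup_le
    (iSup₂_le fun u _ => (measurable_of_isBrownian hW u).comap_le)
    (MeasurableSpace.generateFrom_le fun _ hA => Measure.IsComplete.out' _ hA)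

/-- Simple adapted processes `H_s = ∑_{i < n} a_i 1_{(t_i, t_{i+1}]}(s)` with `t_0 ≤ t_1 ≤ …` and
`a_i` bounded and `ℱ_{t_i}`-measurable. -/
structure SimpleProcess (hW : IsBrownianReal W P) where
  n : ℕ
  t : ℕ → ℝ≥0
  mono : Monotone t
  a : ℕ → Ω → ℝ
  measurable : ∀ i, Measurable[brownianFiltration hW (t i)] (a i)
  bounded : ∃ C : ℝ, ∀ i ω, |a i ω| ≤ C

/-- The value `H_s(ω)` of a simple process. -/
def SimpleProcess.value {hW : IsBrownianReal W P} (H : SimpleProcess hW) (s : ℝ≥0) (ω : Ω) : ℝ :=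
  ∑ i ∈ Finset.range H.n, (Set.Ioc (H.t i) (H.t (i + 1))).indicator (fun _ => H.a i ω) s

/-- The elementary stochastic integral
`∫₀ᵗ H dW = ∑_{i < n} a_i (W_{t_{i+1} ∧ t} - W_{t_i ∧ t})`. -/
def SimpleProcess.integral {hW : IsBrownianReal W P} (H : SimpleProcess hW) (t : ℝ≥0) (ω : Ω) : ℝ :=
  ∑ i ∈ Finset.range H.n, H.a i ω * (W (min (H.t (i + 1)) t) ω - W (min (H.t i) t) ω)

/-- `I` is a continuous version of the Itô integral process `t ↦ ∫₀ᵗ θ dW`: there are simple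
processes `Hⁿ` with `E ∫₀ᵗ |Hⁿ_s - θ_s|² ds → 0` and `E |∫₀ᵗ Hⁿ dW - I_t|² → 0` for all `t`. -/
def IsItoIntegral (hW : IsBrownianReal W P) (θ : ℝ≥0 → Ω → ℝ) (I : Ω → PathSpace) : Prop :=
  (∀ t, Measurable fun ω => (I ω).1 t) ∧
  ∃ H : ℕ → SimpleProcess hW, ∀ t : ℝ≥0,
    Tendsto (fun n => ∫⁻ ω, (∫⁻ s in Set.Ioc (0 : ℝ) t,
      ‖(H n).value s.toNNReal ω - θ s.toNNReal ω‖ₑ ^ 2) ∂P) atTop (𝓝 0) ∧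
    Tendsto (fun n => ∫⁻ ω, ‖(H n).integral t ω - (I ω).1 t‖ₑ ^ 2 ∂P) atTop (𝓝 0)

/-- The set `𝒜^Θ` of admissible controls. -/
structure Control (hW : IsBrownianReal W P) (Θ : Set ℝ) where
  toFun : ℝ≥0 → Ω → ℝ
  mem : ∀ s ω, toFun s ω ∈ Θ
  progressive : IsStronglyProgressive (brownianFiltration hW) toFun
  sq_integrable : ∀ T : ℝ≥0,
    ∫⁻ ω, (∫⁻ s in Set.Ioc (0 : ℝ) T, ‖toFun s.toNNReal ω‖ₑ ^ 2) ∂P < ∞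

variable {hW : IsBrownianReal W P} {Θ : Set ℝ}

open Classical in
/-- The controlled process `B^θ_t = ∫₀ᵗ θ_s dW_s`, as a random continuous path. Continuous versions
of the Itô integral exist and are unique up to a null set; one of them is chosen. (The other branch
of the definition is never taken.) -/
def Control.path (θ : Control hW Θ) : Ω → PathSpace :=
  if h : ∃ I, IsItoIntegral hW θ.toFun I then h.choose else fun _ => ⟨0, rfl⟩

theorem Control.measurable_path (θ : Control hW Θ) (t : ℝ≥0) :
    Measurable fun ω => (θ.path ω).1 t := by
  unfold Control.path
  split_ifs with h
  · exact h.choose_spec.1 t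
  · exact measurable_const

theorem measurable_cylinder {T : ℝ≥0} (ξ : cylinderFunctions T) (θ : Control hW Θ) :
    Measurable fun ω => ξ.1 (θ.path ω) := by
  obtain ⟨n, t, φ, hφ, h⟩ := ξ.2
  simp only [h]
  exact hφ.continuous.measurable.comp (measurable_pi_lambda _ fun i => θ.measurable_path _)

/-! ### The `G`-expectation and the spaces `L_G^p(Ω_T)` -/

/-- The `G`-expectation (of nonnegative path functionals): the supremum over all controls of the
linear expectations of the functional evaluated along `B^θ`. -/
def gExp (hW : IsBrownianReal W P) (Θ : Set ℝ) (Z : PathSpace → ℝ≥0∞) : ℝ≥0∞ :=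
  ⨆ θ : Control hW Θ, ∫⁻ ω, Z (θ.path ω) ∂P

/-- The cylinder functions, to be equipped with the `L_G^p`-distance. -/
def GCylinder (_hW : IsBrownianReal W P) (_Θ : Set ℝ) (T : ℝ≥0) {p : ℝ} (_hp : 0 < p) : Type :=
  cylinderFunctions T

/-- The `L_G^p`-distance on cylinder functions: `Ê[|ξ - η|^p]^{1/p}` for `p ≥ 1`, and
`Ê[|ξ - η|^p]` for `p < 1` (where `Ê[|·|^p]^{1/p}` is only a quasi-norm; the uniform structure is
the same). -/
instance (hW : IsBrownianReal W P) (Θ : Set ℝ) (T : ℝ≥0) {p : ℝ} (hp : 0 < p) :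
    PseudoEMetricSpace (GCylinder hW Θ T hp) where
  edist ξ η := (gExp hW Θ fun x => ‖ξ.1 x - η.1 x‖ₑ ^ p) ^ (min 1 p⁻¹)
  edist_self ξ := by
    have h1 : 0 < min 1 p⁻¹ := lt_min one_pos (inv_pos.2 hp)
    simp [gExp, ENNReal.zero_rpow_of_pos hp, ENNReal.zero_rpow_of_pos h1]
  edist_comm ξ η := by
    have h : ∀ x, ‖ξ.1 x - η.1 x‖ₑ = ‖η.1 x - ξ.1 x‖ₑ := fun x => by
      rw [← enorm_neg, neg_sub]
    simp only [h]
  edist_triangle ξ η ζ := by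
    have h := iSup_lintegral_triangle (P := P) hp
      (fun (θ : Control hW Θ) ω => ξ.1 (θ.path ω) - η.1 (θ.path ω))
      (fun (θ : Control hW Θ) ω => η.1 (θ.path ω) - ζ.1 (θ.path ω))
      (fun θ => ((measurable_cylinder ξ θ).sub (measurable_cylinder η θ)).aemeasurable)
      (fun θ => ((measurable_cylinder η θ).sub (measurable_cylinder ζ θ)).aemeasurable)
    simpa only [gExp, sub_add_sub_cancel] using h

/-- The space `L_G^p(Ω_T)`: the completion of the cylinder functions. -/
abbrev LG (hW : IsBrownianReal W P) (Θ : Set ℝ) (T : ℝ≥0) {p : ℝ} (hp : 0 < p) : Type :=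
  UniformSpace.Completion (GCylinder hW Θ T hp)

/-- A cylinder function as an element of `L_G^p(Ω_T)`. -/
def LG.of (hW : IsBrownianReal W P) (Θ : Set ℝ) {T : ℝ≥0} {p : ℝ} (hp : 0 < p)
    (ξ : cylinderFunctions T) : LG hW Θ T hp :=
  UniformSpace.Completion.coe' (α := GCylinder hW Θ T hp) ξ

/-- The product `L_G^p(Ω_T) × L_G^p(Ω_T) → L_G^{p/2}(Ω_T)`: the extension by continuity of the
pointwise product of cylinder functions. -/
def LG.mul {T : ℝ≥0} {p : ℝ} {hp : 0 < p} (X Y : LG hW Θ T hp) : LG hW Θ T (half_pos hp) :=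
  ((UniformSpace.Completion.isDenseInducing_coe (α := GCylinder hW Θ T hp)).prodMap
    (UniformSpace.Completion.isDenseInducing_coe (α := GCylinder hW Θ T hp))).extend
    (fun z => LG.of hW Θ (half_pos hp)
      ((show cylinderFunctions T from z.1) * (show cylinderFunctions T from z.2))) (X, Y)

/-! ### Families of random variables and the map `Φ` -/

/-- Families `{X^θ}` of (a.e. classes of) random variables indexed by the controls, to be equipped
with the distance of uniform in `θ` convergence in `L^p(P)`. -/
def RandomFamily (hW : IsBrownianReal W P) (Θ : Set ℝ) {p : ℝ} (_hp : 0 < p) : Type _ :=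
  Control hW Θ → (Ω →ₘ[P] ℝ)

/-- The distance `sup_θ E[|X^θ - Y^θ|^p]^{1/p}` (without the exponent `1/p` if `p < 1`). -/
instance (hW : IsBrownianReal W P) (Θ : Set ℝ) {p : ℝ} (hp : 0 < p) :
    PseudoEMetricSpace (RandomFamily hW Θ hp) where
  edist X Y := (⨆ θ : Control hW Θ, ∫⁻ ω, ‖X θ ω - Y θ ω‖ₑ ^ p ∂P) ^ (min 1 p⁻¹)
  edist_self X := by
    have h1 : 0 < min 1 p⁻¹ := lt_min one_pos (inv_pos.2 hp)
    simp [ENNReal.zero_rpow_of_pos hp, ENNReal.zero_rpow_of_pos h1]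
  edist_comm X Y := by
    have h : ∀ (θ : Control hW Θ) ω, ‖X θ ω - Y θ ω‖ₑ = ‖Y θ ω - X θ ω‖ₑ := fun θ ω => by
      rw [← enorm_neg, neg_sub]
    simp only [h]
  edist_triangle X Y Z := by
    have h := iSup_lintegral_triangle (P := P) hp
      (fun (θ : Control hW Θ) ω => X θ ω - Y θ ω)
      (fun (θ : Control hW Θ) ω => Y θ ω - Z θ ω)
      (fun θ => (X θ).aestronglyMeasurable.aemeasurable.sub
        (Y θ).aestronglyMeasurable.aemeasurable)
      (fun θ => (Y θ).aestronglyMeasurable.aemeasurable.sub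
        (Z θ).aestronglyMeasurable.aemeasurable)
    simpa only [sub_add_sub_cancel] using h

/-- `Φ` on cylinder functions: the family `ξ^θ = ξ(B^θ)`, that is,
`ξ^θ = φ(B^θ_{t₁ ∧ T}, …, B^θ_{tₙ ∧ T})` if `ξ = φ(B_{t₁ ∧ T}, …, B_{tₙ ∧ T})`. -/
def PhiCyl (hW : IsBrownianReal W P) (Θ : Set ℝ) {T : ℝ≥0} {p : ℝ} (hp : 0 < p)
    (ξ : cylinderFunctions T) : RandomFamily hW Θ hp :=
  fun θ => AEEqFun.mk (fun ω => ξ.1 (θ.path ω)) (measurable_cylinder ξ θ).aestronglyMeasurable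

/-- The map `Φ` on `L_G^p(Ω_T)`: the extension of `PhiCyl` by continuity. -/
def Phi {T : ℝ≥0} {p : ℝ} {hp : 0 < p} : LG hW Θ T hp → RandomFamily hW Θ hp :=
  UniformSpace.Completion.extension (α := GCylinder hW Θ T hp) (PhiCyl hW Θ hp)

end GExpectation

end

/-! The key fact is that `PhiCyl` is an isometry. The `L_G^q`-distance of two cylinder functions and
the uniform `L^q(P)`-distance of their families are the same supremum over `θ` (`isometry_phiCyl`).
The space of families is T0 and complete (Riesz–Fischer, uniformly in `θ`), so `Φ` extends to the
completion, and questions about products can be decided among honest random variables.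

There, Cauchy–Schwarz for each fixed `θ` bounds the `p/2`-moment of a product by the `p`-moments of
its factors (`supMoment_mul_le`). Together with `fg - FG = (f-F)(g-G) + (f-F)G + (g-G)F`, this makes
multiplication continuous at pairs of families with finite moments. Since `Φ` is multiplicative on
cylinder functions, products of approximating cylinder functions have convergent images, hence are
Cauchy in `L_G^{p/2}`. So the product extends, and the identity for `Φ` passes from the dense set of
cylinder functions to all of `L_G^p`.

The probabilistic input is finiteness of moments. If `Θ ⊆ [-K, K]`, then `E exp(±B^θ_t) ≤ exp(K² t /
2)` for all `θ`, which dominates every function of polynomial growth. For simple integrands, the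
Gaussian increments are integrated out one at a time. The general case follows by truncating the
approximating simple processes at level `K`, which the Itô isometry permits, and by Fatou's lemma.
-/

namespace GExpectation

/-! ### Uniform moments of families of random variables -/

section Families

variable {Ω ι : Type*} [MeasurableSpace Ω] {P : Measure Ω}

/-- The largest absolute `p`-th moment of a family of random variables. -/
noncomputable def supMoment (P : Measure Ω) (p : ℝ) (f : ι → Ω → ℝ) : ℝ≥0∞ :=
  ⨆ i, ∫⁻ ω, ‖f i ω‖ₑ ^ p ∂P

theorem supMoment_congr {p : ℝ} {f g : ι → Ω → ℝ} (h : ∀ i, f i =ᵐ[P] g i) :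
    supMoment P p f = supMoment P p g := by
  refine iSup_congr fun i => lintegral_congr_ae ?_
  filter_upwards [h i] with ω hω
  rw [hω]

/-- Cauchy–Schwarz for `|f i|^(p/2)` and `|g i|^(p/2)`, separately for each `i`. This is where a
product loses half of the exponent. -/
theorem supMoment_mul_le {p : ℝ} {f g : ι → Ω → ℝ}
    (hf : ∀ i, AEMeasurable (f i) P) (hg : ∀ i, AEMeasurable (g i) P) :
    supMoment P (p / 2) (fun i ω => f i ω * g i ω) ≤
      supMoment P p f ^ (1 / 2 : ℝ) * supMoment P p g ^ (1 / 2 : ℝ) := by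
  refine iSup_le fun i => ?_
  have h22 : Real.HolderConjugate 2 2 := Real.HolderConjugate.two_two
  have hpow : ∀ x : ℝ≥0∞, (x ^ (p / 2)) ^ (2 : ℝ) = x ^ p := fun x => by
    rw [← ENNReal.rpow_mul, div_mul_cancel₀ _ two_ne_zero]
  have := ENNReal.lintegral_mul_le_Lp_mul_Lq P h22 ((hf i).enorm.pow_const (p / 2))
    ((hg i).enorm.pow_const (p / 2))
  simp only [Pi.mul_apply, hpow] at this
  calc ∫⁻ ω, ‖f i ω * g i ω‖ₑ ^ (p / 2) ∂P
      = ∫⁻ ω, ‖f i ω‖ₑ ^ (p / 2) * ‖g i ω‖ₑ ^ (p / 2) ∂P := by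
        refine lintegral_congr fun ω => ?_
        rw [enorm_mul, ENNReal.mul_rpow_of_ne_top enorm_ne_top enorm_ne_top]
    _ ≤ _ := this
    _ ≤ _ := by
      gcongr
      · exact le_iSup (fun i => ∫⁻ ω, ‖f i ω‖ₑ ^ p ∂P) i
      · exact le_iSup (fun i => ∫⁻ ω, ‖g i ω‖ₑ ^ p ∂P) i

theorem min_one_inv_pos {p : ℝ} (hp : 0 < p) : 0 < min 1 p⁻¹ := lt_min one_pos (inv_pos.2 hp)

/-- Removes the exponent `min 1 p⁻¹` of the distances from questions of convergence. -/
theorem tendsto_rpow_zero_iff {κ : Type*} {l : Filter κ} {c : ℝ} (hc : 0 < c) {x : κ → ℝ≥0∞} :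
    Tendsto (fun k => x k ^ c) l (𝓝 0) ↔ Tendsto x l (𝓝 0) := by
  constructor <;> intro h
  · have := h.ennrpow_const c⁻¹
    simpa [← ENNReal.rpow_mul, hc.ne', hc] using this
  · simpa [hc] using h.ennrpow_const c

theorem tendsto_supMoment_add {κ : Type*} {l : Filter κ} {p : ℝ} (hp : 0 < p)
    {f g : κ → ι → Ω → ℝ} (hf : ∀ k i, AEMeasurable (f k i) P) (hg : ∀ k i, AEMeasurable (g k i) P)
    (h : Tendsto (fun k => supMoment P p (f k)) l (𝓝 0))
    (h' : Tendsto (fun k => supMoment P p (g k)) l (𝓝 0)) :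
    Tendsto (fun k => supMoment P p (fun i ω => f k i ω + g k i ω)) l (𝓝 0) := by
  have hc := min_one_inv_pos hp
  rw [← tendsto_rpow_zero_iff hc] at h h' ⊢
  have := h.add h'
  rw [add_zero] at this
  exact tendsto_of_tendsto_of_tendsto_of_le_of_le tendsto_const_nhds this (fun _ => zero_le)
    fun k => iSup_lintegral_triangle hp _ _ (hf k) (hg k)

/-- A general finite limit `C` covers both uses: a second factor that also tends to zero, and a
fixed one with finite moment. -/
theorem tendsto_supMoment_mul {κ : Type*} {l : Filter κ} {p : ℝ}
    {f g : κ → ι → Ω → ℝ} (hf : ∀ k i, AEMeasurable (f k i) P) (hg : ∀ k i, AEMeasurable (g k i) P)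
    {C : ℝ≥0∞} (hC : C ≠ ∞)
    (h : Tendsto (fun k => supMoment P p (f k)) l (𝓝 0))
    (h' : Tendsto (fun k => supMoment P p (g k)) l (𝓝 C)) :
    Tendsto (fun k => supMoment P (p / 2) (fun i ω => f k i ω * g k i ω)) l (𝓝 0) := by
  have h1 := h.ennrpow_const (1 / 2)
  have h2 := h'.ennrpow_const (1 / 2)
  have := ENNReal.Tendsto.mul h1 (Or.inr (by simp [hC])) h2 (Or.inr (by simp))
  simp only [one_div, inv_pos, Nat.ofNat_pos, ENNReal.zero_rpow_of_pos, zero_mul] at this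
  refine tendsto_of_tendsto_of_tendsto_of_le_of_le tendsto_const_nhds this (fun _ => zero_le)
    fun k => ?_
  simpa using supMoment_mul_le (p := p) (hf k) (hg k)

theorem supMoment_add_lt_top {p : ℝ} (hp : 0 < p) {f g : ι → Ω → ℝ}
    (hf : ∀ i, AEMeasurable (f i) P) (hg : ∀ i, AEMeasurable (g i) P)
    (h : supMoment P p f < ∞) (h' : supMoment P p g < ∞) :
    supMoment P p (fun i ω => f i ω + g i ω) < ∞ := by
  have hc := min_one_inv_pos hp
  have := (iSup_lintegral_triangle hp f g hf hg).trans_lt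
    (ENNReal.add_lt_top.2 ⟨ENNReal.rpow_lt_top_of_nonneg hc.le h.ne,
      ENNReal.rpow_lt_top_of_nonneg hc.le h'.ne⟩)
  rwa [ENNReal.rpow_lt_top_iff_of_pos hc] at this

/-- Convergence of products in the mean of order `p / 2`, uniformly over a family. -/
theorem tendsto_supMoment_mul_sub_mul {κ : Type*} {l : Filter κ} {p : ℝ} (hp : 0 < p)
    {f g : κ → ι → Ω → ℝ} {F G : ι → Ω → ℝ}
    (hf : ∀ k i, AEMeasurable (f k i) P) (hg : ∀ k i, AEMeasurable (g k i) P)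
    (hF : ∀ i, AEMeasurable (F i) P) (hG : ∀ i, AEMeasurable (G i) P)
    (hFt : supMoment P p F < ∞) (hGt : supMoment P p G < ∞)
    (h : Tendsto (fun k => supMoment P p (fun i ω => f k i ω - F i ω)) l (𝓝 0))
    (h' : Tendsto (fun k => supMoment P p (fun i ω => g k i ω - G i ω)) l (𝓝 0)) :
    Tendsto (fun k => supMoment P (p / 2) (fun i ω => f k i ω * g k i ω - F i ω * G i ω)) l
      (𝓝 0) := by
  have mf := fun k i => (hf k i).sub (hF i)
  have mg := fun k i => (hg k i).sub (hG i)
  -- The three terms of `fg - FG = (f-F)(g-G) + (f-F)G + (g-G)F`. Only the limits `F` and `G` need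
  -- finite moments.
  have t1 := tendsto_supMoment_mul mf mg ENNReal.zero_ne_top h h'
  have t2 := tendsto_supMoment_mul mf (fun _ => hG) hGt.ne h tendsto_const_nhds
  have t3 := tendsto_supMoment_mul mg (fun _ => hF) hFt.ne h' tendsto_const_nhds
  have := tendsto_supMoment_add (half_pos hp) (fun k i => (mf k i).mul (mg k i))
    (fun k i => ((mf k i).mul (hG i)).add ((mg k i).mul (hF i))) t1
    (tendsto_supMoment_add (half_pos hp) (fun k i => (mf k i).mul (hG i))
      (fun k i => (mg k i).mul (hF i)) t2 t3)
  refine this.congr fun k => ?_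
  refine supMoment_congr fun i => Eventually.of_forall fun ω => ?_
  simp only [Pi.mul_apply, Pi.sub_apply, Pi.add_apply]
  ring

/-- A sequence whose increments have rapidly decreasing `q`-th moments converges almost surely. -/
theorem exists_ae_tendsto_of_lintegral_le {q : ℝ} (hq : 0 < q) {f : ℕ → Ω → ℝ}
    (hf : ∀ n, AEMeasurable (f n) P)
    (h : ∀ n : ℕ, ∫⁻ ω, (2 ^ n * ‖f (n + 1) ω - f n ω‖ₑ) ^ q ∂P ≤ 2⁻¹ ^ n) :
    ∃ g : Ω → ℝ, Measurable g ∧ ∀ᵐ ω ∂P, Tendsto (fun n => f n ω) atTop (𝓝 (g ω)) := by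
  have hm : ∀ n : ℕ, AEMeasurable (fun ω => (2 ^ n * ‖f (n + 1) ω - f n ω‖ₑ) ^ q) P := fun n =>
    (((hf (n + 1)).sub (hf n)).enorm.const_mul _).pow_const _
  have hsum : ∫⁻ ω, ∑' n : ℕ, (2 ^ n * ‖f (n + 1) ω - f n ω‖ₑ) ^ q ∂P ≠ ∞ := by
    rw [lintegral_tsum hm]
    refine ne_top_of_le_ne_top ?_ (ENNReal.tsum_le_tsum h)
    rw [ENNReal.tsum_geometric]
    simp
  have hae := ae_lt_top' (AEMeasurable.tsum hm) hsum
  refine measurable_limit_of_tendsto_metrizable_ae hf ?_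
  filter_upwards [hae] with ω hω
  -- The terms of a convergent series are eventually below `1`, so the increments are eventually
  -- below `2⁻ⁿ`. No triangle inequality in `L^q` is involved, so `q < 1` is allowed.
  have h0 := ENNReal.tendsto_atTop_zero_of_tsum_ne_top hω.ne
  refine cauchySeq_tendsto_of_complete (cauchySeq_of_summable_dist ?_)
  refine Summable.of_norm_bounded_eventually_nat (g := fun n => (1 / 2 : ℝ) ^ n)
    (summable_geometric_of_lt_one (by norm_num) (by norm_num)) ?_
  filter_upwards [h0.eventually_lt_const one_pos] with n hn
  have h1 : 2 ^ n * ‖f (n + 1) ω - f n ω‖ₑ < 1 := by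
    by_contra! hcon
    exact absurd hn (not_lt.2 (ENNReal.one_le_rpow hcon hq))
  have h2 : (2 : ℝ) ^ n * ‖f (n + 1) ω - f n ω‖ < 1 := by
    have := (ENNReal.toReal_lt_toReal h1.ne_top ENNReal.one_ne_top).2 h1
    simpa using this
  rw [Real.norm_of_nonneg dist_nonneg, dist_comm, Real.dist_eq, one_div, inv_pow, ← one_div,
    le_div_iff₀' (by positivity)]
  exact h2.le

end Families

/-! ### The space of families is separated and complete -/

section RandomFamily

variable {Ω : Type*} [mΩ : MeasurableSpace Ω] {P : Measure Ω} [P.IsComplete] {W : ℝ≥0 → Ω → ℝ}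
  {hW : IsBrownianReal W P} {Θ : Set ℝ} {p : ℝ} {hp : 0 < p}

theorem RandomFamily.aemeasurable (X : RandomFamily hW Θ hp) (θ : Control hW Θ) :
    AEMeasurable (X θ) P :=
  (X θ).aestronglyMeasurable.aemeasurable

theorem RandomFamily.edist_eq (X Y : RandomFamily hW Θ hp) :
    edist X Y = supMoment P p (fun θ ω => X θ ω - Y θ ω) ^ (min 1 p⁻¹) := rfl

theorem RandomFamily.tendsto_iff {κ : Type*} {l : Filter κ} {X : κ → RandomFamily hW Θ hp}
    {Y : RandomFamily hW Θ hp} :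
    Tendsto X l (𝓝 Y) ↔ Tendsto (fun k => supMoment P p (fun θ ω => X k θ ω - Y θ ω)) l (𝓝 0) := by
  rw [tendsto_iff_edist_tendsto_0]
  exact tendsto_rpow_zero_iff (min_one_inv_pos hp)

/-- The entries are a.e. classes, so distance zero forces equality. This gives the uniqueness of
limits needed to extend `Φ` and to argue by density. -/
instance : T0Space (RandomFamily hW Θ hp) := by
  refine ⟨fun X Y h => ?_⟩
  have h0 : edist X Y = 0 := EMetric.inseparable_iff.1 h
  rw [RandomFamily.edist_eq, ENNReal.rpow_eq_zero_iff_of_pos (min_one_inv_pos hp)] at h0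
  funext θ
  have h1 : ∫⁻ ω, ‖X θ ω - Y θ ω‖ₑ ^ p ∂P = 0 := (ENNReal.iSup_eq_zero.1 h0) θ
  have hm : AEMeasurable (fun ω => ‖X θ ω - Y θ ω‖ₑ ^ p) P :=
    ((X.aemeasurable θ).sub (Y.aemeasurable θ)).enorm.pow_const p
  rw [lintegral_eq_zero_iff' hm] at h1
  refine AEEqFun.ext ?_
  filter_upwards [h1] with ω hω
  rw [Pi.zero_apply, ENNReal.rpow_eq_zero_iff_of_pos hp, enorm_eq_zero, sub_eq_zero] at hω
  exact hω

/-- For each `θ` a fast Cauchy sequence converges almost surely; Fatou's lemma then returns the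
Cauchy bound, which does not depend on `θ`. -/
instance : CompleteSpace (RandomFamily hW Θ hp) := by
  have hc := min_one_inv_pos hp
  -- The exponent `(min 1 p⁻¹)⁻¹` is `max 1 p`, so it dominates both `1` and `p`.
  have hc1 : 1 ≤ (min 1 p⁻¹)⁻¹ := (one_le_inv₀ hc).2 (min_le_left _ _)
  have hcp : p ≤ (min 1 p⁻¹)⁻¹ := (le_inv_comm₀ hp hc).2 (min_le_right _ _)
  have h4 : (4 : ℝ≥0∞) = 2 * 2 := by norm_num
  -- The rate `4⁻ⁿ` absorbs the weight `2ⁿ` of `exists_ae_tendsto_of_lintegral_le` and leaves the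
  -- summable `2⁻ⁿ`.
  refine EMetric.complete_of_convergent_controlled_sequences (fun n => 4⁻¹ ^ n)
    (fun n => by simp [pos_iff_ne_zero]) fun u hu => ?_
  have key : ∀ N n m θ, N ≤ n → N ≤ m →
      ∫⁻ ω, ‖u n θ ω - u m θ ω‖ₑ ^ p ∂P ≤ (4⁻¹ ^ N) ^ (min 1 p⁻¹)⁻¹ := by
    intro N n m θ hn hm
    have h1 := (hu N n m hn hm).le
    rw [RandomFamily.edist_eq, ← ENNReal.le_rpow_inv_iff hc] at h1
    exact (le_iSup (fun θ => ∫⁻ ω, ‖u n θ ω - u m θ ω‖ₑ ^ p ∂P) θ).trans h1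
  have hlim : ∀ θ, ∃ g : Ω → ℝ, Measurable g ∧
      ∀ᵐ ω ∂P, Tendsto (fun n => u n θ ω) atTop (𝓝 (g ω)) := by
    intro θ
    refine exists_ae_tendsto_of_lintegral_le hp (fun n => (u n).aemeasurable θ) fun n => ?_
    calc ∫⁻ ω, (2 ^ n * ‖u (n + 1) θ ω - u n θ ω‖ₑ) ^ p ∂P
        = ∫⁻ ω, (2 ^ n) ^ p * ‖u (n + 1) θ ω - u n θ ω‖ₑ ^ p ∂P := by
          simp_rw [ENNReal.mul_rpow_of_nonneg _ _ hp.le]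
      _ = (2 ^ n) ^ p * ∫⁻ ω, ‖u (n + 1) θ ω - u n θ ω‖ₑ ^ p ∂P :=
          lintegral_const_mul' _ _ (by simp)
      _ ≤ (2 ^ n) ^ (min 1 p⁻¹)⁻¹ * (4⁻¹ ^ n) ^ (min 1 p⁻¹)⁻¹ := by
          gcongr
          · exact one_le_pow₀ one_le_two
          · exact key n _ _ θ (Nat.le_succ n) le_rfl
      _ = (2⁻¹ ^ n) ^ (min 1 p⁻¹)⁻¹ := by
          rw [← ENNReal.mul_rpow_of_nonneg _ _ (inv_pos.2 hc).le, ← mul_pow, h4,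
            ENNReal.mul_inv (by simp) (by simp), ← mul_assoc,
            ENNReal.mul_inv_cancel two_ne_zero ENNReal.ofNat_ne_top, one_mul]
      _ ≤ (2⁻¹ ^ n) ^ (1 : ℝ) :=
          ENNReal.rpow_le_rpow_of_exponent_ge (pow_le_one₀ zero_le (by simp)) hc1
      _ = _ := ENNReal.rpow_one _
  choose g hg hlim using hlim
  refine ⟨fun θ => AEEqFun.mk (g θ) (hg θ).aestronglyMeasurable, ?_⟩
  refine RandomFamily.tendsto_iff.2 ?_
  have hgeo : Tendsto (fun n : ℕ => ((4⁻¹ : ℝ≥0∞) ^ n) ^ (min 1 p⁻¹)⁻¹) atTop (𝓝 0) := by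
    rw [tendsto_rpow_zero_iff (inv_pos.2 hc)]
    exact ENNReal.tendsto_pow_atTop_nhds_zero_of_lt_one (by simp)
  refine tendsto_of_tendsto_of_tendsto_of_le_of_le tendsto_const_nhds hgeo (fun _ => zero_le)
    fun n => iSup_le fun θ => ?_
  calc ∫⁻ ω, ‖u n θ ω - AEEqFun.mk (g θ) (hg θ).aestronglyMeasurable ω‖ₑ ^ p ∂P
      ≤ ∫⁻ ω, liminf (fun m => ‖u n θ ω - u m θ ω‖ₑ ^ p) atTop ∂P := by
        refine lintegral_mono_ae ?_
        filter_upwards [hlim θ, AEEqFun.coeFn_mk (g θ) (hg θ).aestronglyMeasurable] with ω h1 h2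
        rw [h2]
        exact ((tendsto_const_nhds.sub h1).enorm.ennrpow_const p).liminf_eq.ge
    _ ≤ liminf (fun m => ∫⁻ ω, ‖u n θ ω - u m θ ω‖ₑ ^ p ∂P) atTop :=
        lintegral_liminf_le' fun m =>
          (((u n).aemeasurable θ).sub ((u m).aemeasurable θ)).enorm.pow_const p
    _ ≤ _ := by
        refine (liminf_le_liminf ?_).trans (liminf_const _).le
        filter_upwards [eventually_ge_atTop n] with m hm using key n n m θ le_rfl hm

end RandomFamily


/-! ### Brownian increments and the augmented right-continuous filtration -/

section Independence

variable {Ω : Type*} [mΩ : MeasurableSpace Ω] {P : Measure Ω}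

/-- Independence passes to almost sure limits. -/
theorem indepFun_of_tendsto_ae [IsProbabilityMeasure P] {X : ℕ → Ω → ℝ} {Y U : Ω → ℝ}
    (hX : ∀ n, AEMeasurable (X n) P) (hY : AEMeasurable Y P) (hU : AEMeasurable U P)
    (h : ∀ n, IndepFun (X n) U P)
    (hlim : ∀ᵐ ω ∂P, Tendsto (fun n => X n ω) atTop (𝓝 (Y ω))) : IndepFun Y U P := by
  refine indepFun_of_bcf hY hU fun f g => ?_
  have hfm : ∀ {Z : Ω → ℝ}, AEMeasurable Z P → ∀ f : BoundedContinuousFunction ℝ ℝ,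
      AEStronglyMeasurable (f ∘ Z) P := fun hZ f =>
    (f.continuous.measurable.comp_aemeasurable hZ).aestronglyMeasurable
  have hprod : ∀ n, ∫ ω, (f ∘ X n * g ∘ U) ω ∂P = (∫ ω, (f ∘ X n) ω ∂P) * ∫ ω, (g ∘ U) ω ∂P :=
    fun n => ((h n).comp f.continuous.measurable g.continuous.measurable).integral_mul_eq_mul_integral
      (hfm (hX n) f) (hfm hU g)
  have h1 : Tendsto (fun n => ∫ ω, (f ∘ X n) ω ∂P) atTop (𝓝 (∫ ω, (f ∘ Y) ω ∂P)) := by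
    refine tendsto_integral_of_dominated_convergence (fun _ => ‖f‖) (fun n => hfm (hX n) f)
      (integrable_const _) (fun n => Eventually.of_forall fun ω => f.norm_coe_le_norm _) ?_
    filter_upwards [hlim] with ω hω using (f.continuous.tendsto _).comp hω
  have h2 : Tendsto (fun n => ∫ ω, (f ∘ X n * g ∘ U) ω ∂P) atTop
      (𝓝 (∫ ω, (f ∘ Y * g ∘ U) ω ∂P)) := by
    refine tendsto_integral_of_dominated_convergence (fun _ => ‖f‖ * ‖g‖)
      (fun n => (hfm (hX n) f).mul (hfm hU g))
      (integrable_const _) (fun n => Eventually.of_forall fun ω => ?_) ?_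
    · rw [Pi.mul_apply, norm_mul]
      exact mul_le_mul (f.norm_coe_le_norm _) (g.norm_coe_le_norm _) (norm_nonneg _) (norm_nonneg _)
    · filter_upwards [hlim] with ω hω
      exact ((f.continuous.tendsto _).comp hω).mul_const _
  simp only [hprod] at h2
  exact tendsto_nhds_unique h2 (h1.mul_const _)

/-- Adding the null sets to a σ-algebra preserves independence. -/
theorem indep_sup_generateFrom_null {m m' : MeasurableSpace Ω} (h : Indep m m' P) :
    Indep m (m' ⊔ MeasurableSpace.generateFrom {A | P A = 0}) P := by
  -- Every set of the enlarged σ-algebra agrees with a set of `m'` up to a null set.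
  have hle : m' ⊔ MeasurableSpace.generateFrom {A | P A = 0} ≤
      eventuallyMeasurableSpace m' (ae P) := by
    refine sup_le (@le_eventuallyMeasurableSpace _ m' _ _)
      (MeasurableSpace.generateFrom_le fun A hA => ?_)
    exact ⟨∅, @MeasurableSet.empty _ m', ae_eq_empty.2 hA⟩
  refine indep_of_indep_of_le_right ?_ hle
  rw [Indep_iff] at h ⊢
  rintro A B hA ⟨B', hB', hBB'⟩
  rw [measure_congr ((ae_eq_refl A).inter hBB'), measure_congr hBB', h A B' hA hB']

variable [P.IsComplete] {W : ℝ≥0 → Ω → ℝ}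

/-- The increments of a Brownian motion after a time are independent of its filtration. -/
theorem indep_increment_brownianFiltration (hW : IsBrownianReal W P) {s t : ℝ≥0} (hst : s ≤ t) :
    Indep (MeasurableSpace.comap (fun ω => W t ω - W s ω) inferInstance)
      (brownianFiltration hW s) P := by
  have : IsProbabilityMeasure P := hW.isGaussianProcess.isProbabilityMeasure
  have hm := measurable_of_isBrownian hW
  rcases hst.eq_or_lt with rfl | hlt
  · simp only [sub_self, MeasurableSpace.comap_const]
    exact indep_bot_left _
  -- The right-continuous `ℱ_s` may look slightly beyond `s`, but it lies in the augmented past of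
  -- every `u > s`. Independence therefore holds for increments starting at `u`, and path continuity
  -- lets `u` decrease to `s`.
  have hu : ∀ u, s < u → u ≤ t → Indep (MeasurableSpace.comap (fun ω => W t ω - W u ω) inferInstance)
      (brownianFiltration hW s) P := by
    intro u hsu hut
    have h0 : Indep (MeasurableSpace.comap (fun ω => W t ω - W u ω) inferInstance)
        (⨆ v ≤ u, MeasurableSpace.comap (W v) inferInstance) P := by
      have h1 := (IndepFun_iff_Indep _ _ _).1 (hW.indepFun_shift u)
      refine indep_of_indep_of_le h1 ?_ (iSup₂_le fun v hv => ?_)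
      · have e : (fun ω => W t ω - W u ω) =
            (fun x : ℝ≥0 → ℝ => x (t - u)) ∘ fun ω r => W (u + r) ω - W u ω := by
          funext ω
          simp [add_tsub_cancel_of_le hut]
        rw [e, ← MeasurableSpace.comap_comp]
        exact MeasurableSpace.comap_mono (measurable_pi_apply _).comap_le
      · have e : W v = (fun x : Set.Iic u → ℝ => x ⟨v, hv⟩) ∘ fun ω r => W r ω := rfl
        rw [e, ← MeasurableSpace.comap_comp]
        exact MeasurableSpace.comap_mono (measurable_pi_apply _).comap_le
    exact indep_of_indep_of_le_right (indep_sup_generateFrom_null h0) (iInf₂_le u hsu)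
  obtain ⟨u, -, hus, hlim⟩ := exists_seq_strictAnti_tendsto' hlt
  rw [Indep_iff]
  rintro _ A ⟨B, hB, rfl⟩ hA
  have hA' : MeasurableSet A := (brownianFiltration hW).le s A hA
  -- The event is replaced by its indicator so that the almost sure limit lemma for random variables
  -- applies.
  have hind : IndepFun (fun ω => W t ω - W s ω) (A.indicator (1 : Ω → ℝ)) P := by
    refine indepFun_of_tendsto_ae (X := fun n ω => W t ω - W (u n) ω)
      (fun n => ((hm t).sub (hm _)).aemeasurable) ((hm t).sub (hm s)).aemeasurable
      (measurable_one.indicator hA').aemeasurable (fun n => ?_) ?_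
    · rw [IndepFun_iff_Indep]
      refine indep_of_indep_of_le_right (hu (u n) (hus n).1 (hus n).2.le) ?_
      exact Measurable.comap_le
        ((@measurable_const ℝ Ω _ (brownianFiltration hW s) 1).indicator hA)
    · filter_upwards [hW.cont] with ω hω
      exact tendsto_const_nhds.sub ((hω.tendsto s).comp hlim)
  have hpre : A = A.indicator (1 : Ω → ℝ) ⁻¹' {1} := by
    ext; simp [Set.indicator]
  have := hind.measure_inter_preimage_eq_mul B {1} hB (measurableSet_singleton 1)
  rwa [← hpre] at this

omit [P.IsComplete] in
theorem hasLaw_increment (hW : IsBrownianReal W P) {s t : ℝ≥0} (hst : s ≤ t) :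
    HasLaw (fun ω => W t ω - W s ω) (gaussianReal 0 (t - s)) P := by
  have h := hW.hasLaw_sub t s
  have e : nndist t.1 s.1 = t - s := by
    rw [← NNReal.coe_inj, coe_nndist, Real.dist_eq, NNReal.coe_sub hst, abs_of_nonneg]
    · rfl
    · exact sub_nonneg.2 hst
  rwa [e] at h

end Independence


/-! ### Sums of adapted multiples of independent Gaussian increments -/

section GaussianSums

variable {Ω : Type*} [mΩ : MeasurableSpace Ω] {P : Measure Ω}

/-- The joint law is a product, so Tonelli's theorem allows `U` to be frozen while `X` is integrated
out. -/
theorem lintegral_of_indepFun {E F : Type*} [MeasurableSpace E] [MeasurableSpace F]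
    [IsFiniteMeasure P] {U : Ω → E} {X : Ω → F} {μ : Measure F} [SFinite μ] (hU : Measurable U)
    (hX : HasLaw X μ P) (hUX : IndepFun U X P) {h : E × F → ℝ≥0∞} (hh : Measurable h) :
    ∫⁻ ω, h (U ω, X ω) ∂P = ∫⁻ ω, ∫⁻ x, h (U ω, x) ∂μ ∂P := by
  have hXm := hX.aemeasurable
  rw [← lintegral_map' (f := h) (g := fun ω => (U ω, X ω)) hh.aemeasurable
    (hU.aemeasurable.prodMk hXm),
    (indepFun_iff_map_prod_eq_prod_map_map hU.aemeasurable hXm).1 hUX,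
    hX.map_eq, lintegral_prod _ hh.aemeasurable,
    lintegral_map hh.lintegral_prod_right' hU]

theorem lintegral_exp_add_mul_gaussianReal (v : ℝ≥0) (s a : ℝ) :
    ∫⁻ x, ENNReal.ofReal (Real.exp (s + a * x)) ∂(gaussianReal 0 v) =
      ENNReal.ofReal (Real.exp s) * ENNReal.ofReal (Real.exp (a ^ 2 * v / 2)) := by
  have hint := integrable_exp_mul_gaussianReal (μ := 0) (v := v) a
  have h := congrFun (mgf_fun_id_gaussianReal (μ := 0) (v := v)) a
  rw [mgf] at h
  simp_rw [Real.exp_add, ENNReal.ofReal_mul (Real.exp_pos s).le]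
  rw [lintegral_const_mul' _ _ ENNReal.ofReal_ne_top,
    ← ofReal_integral_eq_lintegral_ofReal hint (Eventually.of_forall fun x => (Real.exp_pos _).le),
    h]
  congr 3
  ring

theorem lintegral_sq_add_mul_gaussianReal (v : ℝ≥0) (s a : ℝ) :
    ∫⁻ x, ‖s + a * x‖ₑ ^ 2 ∂(gaussianReal 0 v) = ‖s‖ₑ ^ 2 + v * ‖a‖ₑ ^ 2 := by
  have henorm : ∀ y : ℝ, ‖y‖ₑ ^ 2 = ENNReal.ofReal (y ^ 2) := fun y => by
    rw [Real.enorm_eq_ofReal_abs, ← ENNReal.ofReal_pow (abs_nonneg y), sq_abs]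
  have hL : MemLp (fun x : ℝ => x) 2 (gaussianReal 0 v) := memLp_id_gaussianReal 2
  have h1 : Integrable (fun x : ℝ => x) (gaussianReal 0 v) := hL.integrable (by norm_num)
  have h2 : Integrable (fun x : ℝ => x ^ 2) (gaussianReal 0 v) := hL.integrable_sq
  have hvar : ∫ x, x ^ 2 ∂(gaussianReal 0 v) = v := by
    have := variance_fun_id_gaussianReal (μ := 0) (v := v)
    rw [variance_eq_integral (by fun_prop)] at this
    simpa [integral_id_gaussianReal] using this
  have hexp : ∀ x : ℝ, (s + a * x) ^ 2 = s ^ 2 + ((2 * s * a) * x + a ^ 2 * x ^ 2) := fun x => by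
    ring
  have hint : Integrable (fun x : ℝ => (s + a * x) ^ 2) (gaussianReal 0 v) := by
    simp_rw [hexp]
    exact (integrable_const _).add ((h1.const_mul _).add (h2.const_mul _))
  have hlin : Integrable (fun x : ℝ => (2 * s * a) * x + a ^ 2 * x ^ 2) (gaussianReal 0 v) :=
    (h1.const_mul _).add (h2.const_mul _)
  simp_rw [henorm]
  rw [← ofReal_integral_eq_lintegral_ofReal hint (Eventually.of_forall fun x => sq_nonneg _)]
  simp_rw [hexp]
  rw [integral_add (integrable_const _) hlin,
    integral_add (h1.const_mul _) (h2.const_mul _), integral_const_mul, integral_const_mul, hvar,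
    integral_id_gaussianReal]
  simp only [integral_const, probReal_univ, smul_eq_mul, one_mul, mul_zero, zero_add]
  rw [ENNReal.ofReal_add (sq_nonneg s) (by positivity), ENNReal.ofReal_mul (sq_nonneg a),
    ENNReal.ofReal_coe_nnreal, mul_comm]

variable [IsFiniteMeasure P] {G : ℕ → MeasurableSpace Ω} {X a : ℕ → Ω → ℝ} {v : ℕ → ℝ≥0}

omit mΩ in
theorem measurable_sum_mul (hG : Monotone G) (hX : ∀ i, Measurable[G (i + 1)] (X i))
    (ha : ∀ i, Measurable[G i] (a i)) (n : ℕ) :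
    Measurable[G n] fun ω => ∑ i ∈ Finset.range n, a i ω * X i ω := by
  refine @Finset.measurable_fun_sum _ _ _ _ _ _ (G n) _ _ fun i hi => ?_
  have hin := Finset.mem_range.1 hi
  exact Measurable.mul ((ha i).mono (hG hin.le) le_rfl) ((hX i).mono (hG hin) le_rfl)

/-- The first `n` terms and the coefficient `a n` are all `G n`-measurable, hence jointly
independent of `X n`. This is the induction step for both the isometry and the exponential bound. -/
theorem lintegral_sum_mul_succ (hG : Monotone G) (hGle : ∀ i, G i ≤ mΩ)
    (hX : ∀ i, Measurable[G (i + 1)] (X i)) (ha : ∀ i, Measurable[G i] (a i))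
    (hlaw : ∀ i, HasLaw (X i) (gaussianReal 0 (v i)) P)
    (hind : ∀ i, Indep (MeasurableSpace.comap (X i) inferInstance) (G i) P)
    {h : ℝ → ℝ≥0∞} (hh : Measurable h) (n : ℕ) :
    ∫⁻ ω, h (∑ i ∈ Finset.range (n + 1), a i ω * X i ω) ∂P =
      ∫⁻ ω, ∫⁻ x, h ((∑ i ∈ Finset.range n, a i ω * X i ω) + a n ω * x)
        ∂(gaussianReal 0 (v n)) ∂P := by
  have hU : Measurable[G n] fun ω => (∑ i ∈ Finset.range n, a i ω * X i ω, a n ω) :=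
    (measurable_sum_mul hG hX ha n).prodMk (ha n)
  have hUX : IndepFun (fun ω => (∑ i ∈ Finset.range n, a i ω * X i ω, a n ω)) (X n) P := by
    rw [IndepFun_iff_Indep]
    exact indep_of_indep_of_le_left (hind n).symm hU.comap_le
  simp_rw [Finset.sum_range_succ]
  exact lintegral_of_indepFun (h := fun z : (ℝ × ℝ) × ℝ => h (z.1.1 + z.1.2 * z.2))
    (hU.mono (hGle n) le_rfl) (hlaw n) hUX (hh.comp (by fun_prop))

/-- The isometry for sums of adapted multiples of independent Gaussian increments. -/
theorem lintegral_sq_sum_mul (hG : Monotone G) (hGle : ∀ i, G i ≤ mΩ)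
    (hX : ∀ i, Measurable[G (i + 1)] (X i)) (ha : ∀ i, Measurable[G i] (a i))
    (hlaw : ∀ i, HasLaw (X i) (gaussianReal 0 (v i)) P)
    (hind : ∀ i, Indep (MeasurableSpace.comap (X i) inferInstance) (G i) P) (n : ℕ) :
    ∫⁻ ω, ‖∑ i ∈ Finset.range n, a i ω * X i ω‖ₑ ^ 2 ∂P =
      ∑ i ∈ Finset.range n, v i * ∫⁻ ω, ‖a i ω‖ₑ ^ 2 ∂P := by
  induction n with
  | zero => simp
  | succ n ih =>
    have hm : Measurable fun ω => ‖∑ i ∈ Finset.range n, a i ω * X i ω‖ₑ ^ 2 :=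
      ((measurable_sum_mul hG hX ha n).mono (hGle n) le_rfl).enorm.pow_const 2
    rw [lintegral_sum_mul_succ hG hGle hX ha hlaw hind (h := fun y => ‖y‖ₑ ^ 2)
      (measurable_enorm.pow_const 2)]
    simp_rw [lintegral_sq_add_mul_gaussianReal]
    rw [lintegral_add_left hm, lintegral_const_mul' _ _ ENNReal.coe_ne_top, ih,
      Finset.sum_range_succ]

/-- Exponential moments of sums of bounded adapted multiples of independent Gaussian increments. -/
theorem lintegral_exp_sum_mul_le [IsProbabilityMeasure P] (hG : Monotone G) (hGle : ∀ i, G i ≤ mΩ)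
    (hX : ∀ i, Measurable[G (i + 1)] (X i)) (ha : ∀ i, Measurable[G i] (a i))
    (hlaw : ∀ i, HasLaw (X i) (gaussianReal 0 (v i)) P)
    (hind : ∀ i, Indep (MeasurableSpace.comap (X i) inferInstance) (G i) P)
    {K : ℝ} (hK : ∀ i ω, |a i ω| ≤ K) (n : ℕ) :
    ∫⁻ ω, ENNReal.ofReal (Real.exp (∑ i ∈ Finset.range n, a i ω * X i ω)) ∂P ≤
      ENNReal.ofReal (Real.exp (K ^ 2 * (∑ i ∈ Finset.range n, v i : ℝ≥0) / 2)) := by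
  induction n with
  | zero => simp
  | succ n ih =>
    rw [lintegral_sum_mul_succ hG hGle hX ha hlaw hind
      (h := fun y => ENNReal.ofReal (Real.exp y)) (by fun_prop)]
    simp_rw [lintegral_exp_add_mul_gaussianReal]
    -- The deterministic bound on `a n` makes the last factor a constant, which leaves the integral.
    calc _ ≤ ∫⁻ ω, ENNReal.ofReal (Real.exp (∑ i ∈ Finset.range n, a i ω * X i ω)) *
          ENNReal.ofReal (Real.exp (K ^ 2 * v n / 2)) ∂P := by
          refine lintegral_mono fun ω => ?_
          have : a n ω ^ 2 ≤ K ^ 2 := sq_le_sq.2 ((hK n ω).trans (le_abs_self K))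
          gcongr
      _ ≤ _ := by
          rw [lintegral_mul_const' _ _ ENNReal.ofReal_ne_top]
          grw [ih]
          rw [← ENNReal.ofReal_mul (Real.exp_pos _).le, ← Real.exp_add, Finset.sum_range_succ,
            NNReal.coe_add]
          refine le_of_eq ?_
          congr 2
          ring

end GaussianSums

/-! ### Elementary stochastic integrals -/

section SimpleProcesses

variable {Ω : Type*} [mΩ : MeasurableSpace Ω] {P : Measure Ω} [P.IsComplete] {W : ℝ≥0 → Ω → ℝ}
  {hW : IsBrownianReal W P}

/-- Only one term of a simple process is nonzero at any given time. -/
theorem SimpleProcess.map_value {M : Type*} [AddCommMonoid M] (H : SimpleProcess hW) {g : ℝ → M}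
    (hg : g 0 = 0) (s : ℝ≥0) (ω : Ω) :
    g (H.value s ω) = ∑ i ∈ Finset.range H.n,
      (Set.Ioc (H.t i) (H.t (i + 1))).indicator (fun _ => g (H.a i ω)) s := by
  unfold SimpleProcess.value
  by_cases h : ∃ i ∈ Finset.range H.n, s ∈ Set.Ioc (H.t i) (H.t (i + 1))
  · obtain ⟨i, hi, hs⟩ := h
    have hne : ∀ j, j ≠ i → s ∉ Set.Ioc (H.t j) (H.t (j + 1)) := fun j hj hsj =>
      (Set.disjoint_left.1 (H.mono.pairwise_disjoint_on_Ioc_succ hj) hsj) hs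
    rw [Finset.sum_eq_single_of_mem i hi fun j _ hj => Set.indicator_of_notMem (hne j hj) _,
      Finset.sum_eq_single_of_mem i hi fun j _ hj => Set.indicator_of_notMem (hne j hj) _,
      Set.indicator_of_mem hs, Set.indicator_of_mem hs]
  · push Not at h
    rw [Finset.sum_eq_zero fun i hi => Set.indicator_of_notMem (h i hi) _,
      Finset.sum_eq_zero fun i hi => Set.indicator_of_notMem (h i hi) _, hg]

/-- Composition of a simple process with a function that does not increase absolute values. -/
def SimpleProcess.comp (H : SimpleProcess hW) (g : ℝ → ℝ) (hg : Measurable g)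
    (hle : ∀ x, |g x| ≤ |x|) : SimpleProcess hW where
  n := H.n
  t := H.t
  mono := H.mono
  a i ω := g (H.a i ω)
  measurable i := hg.comp (H.measurable i)
  bounded := H.bounded.imp fun _ h i ω => (hle _).trans (h i ω)

theorem SimpleProcess.comp_value (H : SimpleProcess hW) {g : ℝ → ℝ} (hg : Measurable g)
    (hle : ∀ x, |g x| ≤ |x|) (s : ℝ≥0) (ω : Ω) :
    (H.comp g hg hle).value s ω = g (H.value s ω) := by
  have h0 : g 0 = 0 := by simpa using hle 0
  rw [H.map_value h0]
  rfl

/-- The coefficients of a simple process, cut off at a time. -/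
noncomputable def SimpleProcess.stopped (H : SimpleProcess hW) (t : ℝ≥0) (i : ℕ) : Ω → ℝ :=
  if H.t i ≤ t then H.a i else 0

/-- If `t < t_i`, the increment vanishes and its coefficient may be set to zero. The coefficient is
then measurable already at time `t_i ∧ t`, as the Gaussian sum lemmas require. -/
theorem SimpleProcess.integral_eq (H : SimpleProcess hW) (t : ℝ≥0) (ω : Ω) :
    H.integral t ω = ∑ i ∈ Finset.range H.n, H.stopped t i ω *
      (W (min (H.t (i + 1)) t) ω - W (min (H.t i) t) ω) := by
  refine Finset.sum_congr rfl fun i _ => ?_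
  unfold SimpleProcess.stopped
  split_ifs with h
  · rfl
  · have h1 := (not_le.1 h).le
    rw [min_eq_right h1, min_eq_right (h1.trans (H.mono i.le_succ)), sub_self, mul_zero, mul_zero]

theorem SimpleProcess.measurable_stopped (H : SimpleProcess hW) (t : ℝ≥0) (i : ℕ) :
    Measurable[brownianFiltration hW (min (H.t i) t)] (H.stopped t i) := by
  unfold SimpleProcess.stopped
  split_ifs with h
  · rw [min_eq_left h]
    exact H.measurable i
  · exact @measurable_const _ _ _ (_) 0

theorem SimpleProcess.monotone_min (H : SimpleProcess hW) (t : ℝ≥0) :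
    Monotone fun i => min (H.t i) t := fun _ _ h => min_le_min_right t (H.mono h)

theorem measurable_brownianFiltration (hW : IsBrownianReal W P) {s t : ℝ≥0} (h : s ≤ t) :
    Measurable[brownianFiltration hW t] (W s) := by
  refine Measurable.of_comap_le (le_iInf₂ fun u hu => le_sup_of_le_left ?_)
  exact le_iSup₂_of_le s (h.trans (le_of_lt hu)) le_rfl

theorem SimpleProcess.measurable_increment (H : SimpleProcess hW) (t : ℝ≥0) (i : ℕ) :
    Measurable[brownianFiltration hW (min (H.t (i + 1)) t)]
      fun ω => W (min (H.t (i + 1)) t) ω - W (min (H.t i) t) ω :=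
  @Measurable.sub _ _ _ _ _ (_) _ _ (measurable_brownianFiltration hW le_rfl)
    (measurable_brownianFiltration hW (H.monotone_min t i.le_succ))

theorem SimpleProcess.measurable_integral (H : SimpleProcess hW) (t : ℝ≥0) :
    Measurable (H.integral t) :=
  Finset.measurable_fun_sum _ fun i _ => ((H.measurable i).mono ((brownianFiltration hW).le _)
    le_rfl).mul ((measurable_of_isBrownian hW _).sub (measurable_of_isBrownian hW _))

theorem SimpleProcess.lintegral_sq_value (H : SimpleProcess hW) (t : ℝ≥0) (ω : Ω) :
    ∫⁻ s in Set.Ioc (0 : ℝ) t, ‖H.value s.toNNReal ω‖ₑ ^ 2 =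
      ∑ i ∈ Finset.range H.n,
        (min (H.t (i + 1)) t - min (H.t i) t : ℝ≥0) * ‖H.stopped t i ω‖ₑ ^ 2 := by
  have hpre : ∀ i, MeasurableSet (Real.toNNReal ⁻¹' Set.Ioc (H.t i) (H.t (i + 1))) := fun i =>
    measurable_real_toNNReal measurableSet_Ioc
  have hind : ∀ (i : ℕ) (c : ℝ≥0∞) (s : ℝ),
      (Set.Ioc (H.t i) (H.t (i + 1))).indicator (fun _ => c) s.toNNReal =
        (Real.toNNReal ⁻¹' Set.Ioc (H.t i) (H.t (i + 1))).indicator (fun _ => c) s := fun _ _ _ => rfl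
  simp_rw [H.map_value (g := fun x => ‖x‖ₑ ^ 2) (by simp), hind]
  rw [lintegral_finsetSum _ fun i _ => measurable_const.indicator (hpre i)]
  refine Finset.sum_congr rfl fun i _ => ?_
  rw [lintegral_indicator_const (hpre i), Measure.restrict_apply (hpre i), mul_comm]
  have hset : Real.toNNReal ⁻¹' Set.Ioc (H.t i) (H.t (i + 1)) ∩ Set.Ioc (0 : ℝ) t =
      Set.Ioc ((min (H.t i) t : ℝ≥0) : ℝ) (min (H.t (i + 1)) t : ℝ≥0) := by
    ext s
    simp only [Set.mem_inter_iff, Set.mem_preimage, Set.mem_Ioc, Real.lt_toNNReal_iff_coe_lt,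
      Real.toNNReal_le_iff_le_coe, NNReal.coe_min, le_min_iff, min_lt_iff]
    constructor
    · rintro ⟨⟨h1, h2⟩, h3, h4⟩
      exact ⟨Or.inl h1, h2, h4⟩
    · rintro ⟨h1, h2, h3⟩
      have h1' : (H.t i : ℝ) < s := h1.resolve_right (not_lt.2 h3)
      exact ⟨⟨h1', h2⟩, (H.t i).coe_nonneg.trans_lt h1', h3⟩
  rw [hset, Real.volume_Ioc, ← NNReal.coe_sub (H.monotone_min t i.le_succ),
    ENNReal.ofReal_coe_nnreal]
  unfold SimpleProcess.stopped
  split_ifs with h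
  · rfl
  · have h1 := (not_le.1 h).le
    simp [min_eq_right h1, min_eq_right (h1.trans (H.mono i.le_succ))]

/-- The Itô isometry for simple processes. -/
theorem SimpleProcess.lintegral_sq_integral (H : SimpleProcess hW) (t : ℝ≥0) :
    ∫⁻ ω, ‖H.integral t ω‖ₑ ^ 2 ∂P =
      ∫⁻ ω, (∫⁻ s in Set.Ioc (0 : ℝ) t, ‖H.value s.toNNReal ω‖ₑ ^ 2) ∂P := by
  have : IsProbabilityMeasure P := hW.isGaussianProcess.isProbabilityMeasure
  have hmono := H.monotone_min t
  simp_rw [H.lintegral_sq_value, H.integral_eq]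
  rw [lintegral_sq_sum_mul (G := fun i => brownianFiltration hW (min (H.t i) t))
    (fun _ _ h => (brownianFiltration hW).mono (hmono h))
    (fun i => (brownianFiltration hW).le _) (H.measurable_increment t) (H.measurable_stopped t)
    (fun i => hasLaw_increment hW (hmono i.le_succ))
    (fun i => indep_increment_brownianFiltration hW (hmono i.le_succ)),
    lintegral_finsetSum _ fun i _ => (((H.measurable_stopped t i).mono
      ((brownianFiltration hW).le _) le_rfl).enorm.pow_const 2).const_mul _]
  simp_rw [lintegral_const_mul' _ _ ENNReal.coe_ne_top]

/-- Exponential moments of elementary integrals of bounded simple processes. -/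
theorem SimpleProcess.lintegral_exp_integral_le (H : SimpleProcess hW) {K : ℝ}
    (hK : ∀ i ω, |H.a i ω| ≤ K) (t : ℝ≥0) :
    ∫⁻ ω, ENNReal.ofReal (Real.exp (H.integral t ω)) ∂P ≤
      ENNReal.ofReal (Real.exp (K ^ 2 * t / 2)) := by
  have : IsProbabilityMeasure P := hW.isGaussianProcess.isProbabilityMeasure
  have hmono := H.monotone_min t
  simp_rw [H.integral_eq]
  refine (lintegral_exp_sum_mul_le (G := fun i => brownianFiltration hW (min (H.t i) t)) (K := K)
    (fun _ _ h => (brownianFiltration hW).mono (hmono h))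
    (fun i => (brownianFiltration hW).le _) (H.measurable_increment t) (H.measurable_stopped t)
    (fun i => hasLaw_increment hW (hmono i.le_succ))
    (fun i => indep_increment_brownianFiltration hW (hmono i.le_succ)) (fun i ω => ?_)
    H.n).trans ?_
  · unfold SimpleProcess.stopped
    split_ifs
    · exact hK i ω
    · simpa using (abs_nonneg _).trans (hK i ω)
  -- The variances telescope to a time span of length at most `t`.
  · rw [Finset.sum_range_tsub hmono]
    gcongr
    exact tsub_le_self.trans (min_le_right _ _)

end SimpleProcesses


/-! ### Exponential moments of `B^θ` and moments of cylinder functions -/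

section Moments

variable {Ω : Type*} [mΩ : MeasurableSpace Ω] {P : Measure Ω}

theorem eLpNorm_two_eq (f : Ω → ℝ) :
    eLpNorm f 2 P = (∫⁻ ω, ‖f ω‖ₑ ^ 2 ∂P) ^ (1 / 2 : ℝ) := by
  simp [eLpNorm_eq_lintegral_rpow_enorm_toReal two_ne_zero ENNReal.ofNat_ne_top]

theorem tendsto_eLpNorm_two_iff {κ : Type*} {l : Filter κ} {f : κ → Ω → ℝ} :
    Tendsto (fun k => eLpNorm (f k) 2 P) l (𝓝 0) ↔
      Tendsto (fun k => ∫⁻ ω, ‖f k ω‖ₑ ^ 2 ∂P) l (𝓝 0) := by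
  simp_rw [eLpNorm_two_eq]
  exact tendsto_rpow_zero_iff (by norm_num)

/-- Bounds for exponential moments pass to limits in mean square. -/
theorem lintegral_exp_le_of_tendsto_eLpNorm {f : ℕ → Ω → ℝ} {g : Ω → ℝ}
    (hf : ∀ n, Measurable (f n)) (hg : Measurable g)
    (h : Tendsto (fun n => eLpNorm (f n - g) 2 P) atTop (𝓝 0)) {C : ℝ≥0∞}
    (hC : ∀ n, ∫⁻ ω, ENNReal.ofReal (Real.exp (f n ω)) ∂P ≤ C) :
    ∫⁻ ω, ENNReal.ofReal (Real.exp (g ω)) ∂P ≤ C := by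
  -- An almost surely convergent subsequence is enough for Fatou's lemma.
  obtain ⟨ns, -, hns⟩ := (tendstoInMeasure_of_tendsto_eLpNorm two_ne_zero
    (fun n => (hf n).aestronglyMeasurable) hg.aestronglyMeasurable h).exists_seq_tendsto_ae
  calc ∫⁻ ω, ENNReal.ofReal (Real.exp (g ω)) ∂P
      ≤ ∫⁻ ω, liminf (fun k => ENNReal.ofReal (Real.exp (f (ns k) ω))) atTop ∂P := by
        refine lintegral_mono_ae ?_
        filter_upwards [hns] with ω hω
        exact (ENNReal.tendsto_ofReal ((Real.continuous_exp.tendsto _).comp hω)).liminf_eq.ge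
    _ ≤ liminf (fun k => ∫⁻ ω, ENNReal.ofReal (Real.exp (f (ns k) ω)) ∂P) atTop :=
        lintegral_liminf_le fun k => (Real.measurable_exp.comp (hf _)).ennreal_ofReal
    _ ≤ _ := (liminf_le_liminf (Eventually.of_forall fun k => hC (ns k))).trans (liminf_const _).le

/-- The truncation of a real number at the levels `-K` and `K`. -/
def clip (K x : ℝ) : ℝ := max (-K) (min K x)

theorem abs_clip_le {K : ℝ} (hK : 0 ≤ K) (x : ℝ) : |clip K x| ≤ K := by
  unfold clip
  grind

theorem abs_clip_le_abs {K : ℝ} (hK : 0 ≤ K) (x : ℝ) : |clip K x| ≤ |x| := by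
  unfold clip
  grind

/-- `clip K x` is the point of `[-K, K]` nearest to `x`. -/
theorem abs_sub_clip_le {K y : ℝ} (hy : |y| ≤ K) (x : ℝ) : |x - clip K x| ≤ |x - y| := by
  unfold clip
  grind

theorem measurable_clip (K : ℝ) : Measurable (clip K) :=
  measurable_const.max (measurable_const.min measurable_id)

variable [P.IsComplete] {W : ℝ≥0 → Ω → ℝ} {hW : IsBrownianReal W P} {Θ : Set ℝ}

/-- The Itô integral of a bounded process is a mean square limit of elementary integrals of simple
processes with the same bound. -/
theorem IsItoIntegral.exists_bounded_simpleProcess {θ : ℝ≥0 → Ω → ℝ} {I : Ω → PathSpace}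
    (hI : IsItoIntegral hW θ I) {K : ℝ} (hK : 0 ≤ K) (hθ : ∀ s ω, |θ s ω| ≤ K) (t : ℝ≥0) :
    ∃ H : ℕ → SimpleProcess hW, (∀ n i ω, |(H n).a i ω| ≤ K) ∧
      Tendsto (fun n => eLpNorm ((H n).integral t - fun ω => (I ω).1 t) 2 P) atTop (𝓝 0) := by
  obtain ⟨hIm, H, hH⟩ := hI
  obtain ⟨h1, h2⟩ := hH t
  have hle : ∀ x, |x - clip K x| ≤ |x| := fun x => by
    simpa using abs_sub_clip_le (y := 0) (by simpa using hK) x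
  have hm : Measurable fun x => x - clip K x := measurable_id.sub (measurable_clip K)
  -- The excess `D` over the truncation `H'` satisfies `|D| ≤ |H - θ|` because `θ` takes values in
  -- `[-K, K]`. By the isometry its integral vanishes in mean square, so the integrals of `H'` and
  -- `H` have the same limit.
  let D : ℕ → SimpleProcess hW := fun n => (H n).comp (fun x => x - clip K x) hm hle
  let H' : ℕ → SimpleProcess hW := fun n => (H n).comp (clip K) (measurable_clip K)
    (abs_clip_le_abs hK)
  have hdiff : ∀ n, (H' n).integral t = (H n).integral t - (D n).integral t := fun n => by
    funext ω
    simp only [Pi.sub_apply, SimpleProcess.integral]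
    simp only [H', D, SimpleProcess.comp]
    rw [← Finset.sum_sub_distrib]
    exact Finset.sum_congr rfl fun i _ => by ring
  have hD : Tendsto (fun n => ∫⁻ ω, ‖(D n).integral t ω‖ₑ ^ 2 ∂P) atTop (𝓝 0) := by
    refine tendsto_of_tendsto_of_tendsto_of_le_of_le tendsto_const_nhds h1 (fun _ => zero_le)
      fun n => ?_
    rw [SimpleProcess.lintegral_sq_integral]
    refine lintegral_mono fun ω => lintegral_mono fun s => ?_
    simp only [D, SimpleProcess.comp_value]
    gcongr 1
    rw [enorm_le_iff_norm_le]
    exact abs_sub_clip_le (hθ _ ω) _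
  refine ⟨H', fun n i ω => abs_clip_le hK _, ?_⟩
  rw [← tendsto_eLpNorm_two_iff] at hD
  have h2' := tendsto_eLpNorm_two_iff.2 h2
  have hsum := h2'.add hD
  rw [add_zero] at hsum
  refine tendsto_of_tendsto_of_tendsto_of_le_of_le tendsto_const_nhds hsum (fun _ => zero_le)
    fun n => ?_
  have e : (H' n).integral t - (fun ω => (I ω).1 t) =
      (fun ω => (H n).integral t ω - (I ω).1 t) - (D n).integral t := by
    rw [hdiff]
    funext ω
    simp only [Pi.sub_apply]
    ring
  simp only [e]
  exact eLpNorm_sub_le (((H n).measurable_integral t).sub (hIm t)).aestronglyMeasurable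
    ((D n).measurable_integral t).aestronglyMeasurable one_le_two

/-- Exponential moments of the controlled processes, for controls with values in `[-K, K]`. -/
theorem Control.lintegral_exp_path_le (θ : Control hW Θ) {K : ℝ} (hK : 0 ≤ K)
    (hΘ : ∀ x ∈ Θ, |x| ≤ K) (t : ℝ≥0) {σ : ℝ} (hσ : |σ| = 1) :
    ∫⁻ ω, ENNReal.ofReal (Real.exp (σ * (θ.path ω).1 t)) ∂P ≤
      ENNReal.ofReal (Real.exp (K ^ 2 * t / 2)) := by
  have : IsProbabilityMeasure P := hW.isGaussianProcess.isProbabilityMeasure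
  -- The default path is zero and satisfies the bound trivially, so existence of the Itô integral is
  -- not needed.
  by_cases h : ∃ I, IsItoIntegral hW θ.toFun I
  · have hI : IsItoIntegral hW θ.toFun θ.path := by
      unfold Control.path
      rw [dif_pos h]
      exact h.choose_spec
    obtain ⟨H, hHK, hH⟩ := hI.exists_bounded_simpleProcess hK (fun s ω => hΘ _ (θ.mem s ω)) t
    have hle : ∀ x, |σ * x| ≤ |x| := fun x => by rw [abs_mul, hσ, one_mul]
    have hint : ∀ n, ((H n).comp (σ * ·) (measurable_const_mul σ) hle).integral t =
        σ • (H n).integral t := fun n => by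
      funext ω
      simp only [Pi.smul_apply, smul_eq_mul, SimpleProcess.integral, SimpleProcess.comp,
        Finset.mul_sum, mul_assoc]
    refine lintegral_exp_le_of_tendsto_eLpNorm (f := fun n => σ • (H n).integral t)
      (fun n => ((H n).measurable_integral t).const_smul σ) ((θ.measurable_path t).const_mul σ) ?_
      fun n => ?_
    · refine hH.congr fun n => ?_
      have e : (σ • (H n).integral t - fun ω => σ * (θ.path ω).1 t) =
          σ • ((H n).integral t - fun ω => (θ.path ω).1 t) := by
        rw [smul_sub]
        rfl
      rw [e, eLpNorm_const_smul, ← ofReal_norm, Real.norm_eq_abs, hσ, ENNReal.ofReal_one, one_mul]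
    · rw [← hint]
      exact SimpleProcess.lintegral_exp_integral_le _ (fun i ω => (hle _).trans (hHK n i ω)) t
  · have h0 : ∀ ω, (θ.path ω).1 t = 0 := fun ω => by
      unfold Control.path
      rw [dif_neg h]
      rfl
    simp only [h0, mul_zero, Real.exp_zero, ENNReal.ofReal_one, lintegral_const, measure_univ,
      mul_one]
    rw [← ENNReal.ofReal_one]
    exact ENNReal.ofReal_le_ofReal (Real.one_le_exp (by positivity))

theorem one_add_rpow_le_exp (r : ℝ) : ∃ C : ℝ, 0 ≤ C ∧ ∀ y : ℝ, 0 ≤ y →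
    (1 + y) ^ r ≤ C * Real.exp y := by
  obtain ⟨m, hm⟩ := exists_nat_ge r
  -- The constant comes from `(1 + y)^m / m! ≤ exp (1 + y)` with an integer `m ≥ r`.
  refine ⟨m.factorial * Real.exp 1, by positivity, fun y hy => ?_⟩
  have h1 := Real.pow_div_factorial_le_exp (x := 1 + y) (by positivity) m
  rw [div_le_iff₀' (by positivity), Real.exp_add] at h1
  calc (1 + y) ^ r ≤ (1 + y) ^ (m : ℝ) := Real.rpow_le_rpow_of_exponent_le (by linarith) hm
    _ = (1 + y) ^ m := Real.rpow_natCast _ _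
    _ ≤ _ := by rw [mul_assoc]; exact h1

/-- Reduces the sup norm to one-dimensional exponentials through `exp |x| ≤ exp x + exp (-x)`. The
summand `1` covers `n = 0`; the factors `1` and `-1` are the signs `σ` of
`Control.lintegral_exp_path_le`. -/
theorem exp_norm_le {n : ℕ} (x : Fin n → ℝ) :
    Real.exp ‖x‖ ≤ 1 + ∑ i, (Real.exp (1 * x i) + Real.exp (-1 * x i)) := by
  have hpos : ∀ i, 0 ≤ Real.exp (1 * x i) + Real.exp (-1 * x i) := fun i => by positivity
  have hsum : 0 ≤ ∑ i, (Real.exp (1 * x i) + Real.exp (-1 * x i)) :=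
    Finset.sum_nonneg fun i _ => hpos i
  have hle : ‖x‖ ≤ Real.log (1 + ∑ i, (Real.exp (1 * x i) + Real.exp (-1 * x i))) := by
    refine (pi_norm_le_iff_of_nonneg (Real.log_nonneg (by linarith))).2 fun i => ?_
    rw [Real.le_log_iff_exp_le (by positivity), Real.norm_eq_abs]
    have h1 := Finset.single_le_sum (f := fun i => Real.exp (1 * x i) + Real.exp (-1 * x i))
      (fun i _ => hpos i) (Finset.mem_univ i)
    have h2 := Real.exp_abs_le (x i)
    simp only [one_mul, neg_mul] at h1 h2 ⊢
    linarith
  rwa [Real.le_log_iff_exp_le (by positivity)] at hle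

/-- Cylinder functions have finite moments of all orders under the `G`-expectation. -/
theorem gExp_cylinder_lt_top (hΘ : IsCompact Θ) {T : ℝ≥0} {q : ℝ} (hq : 0 < q)
    (ξ : cylinderFunctions T) : gExp hW Θ (fun x => ‖ξ.1 x‖ₑ ^ q) < ∞ := by
  have : IsProbabilityMeasure P := hW.isGaussianProcess.isProbabilityMeasure
  -- One bound `K` serves all controls, which makes the moment estimate uniform in `θ`.
  obtain ⟨K, hKpos, hK⟩ := hΘ.isBounded.exists_pos_norm_le
  obtain ⟨n, t, φ, hφ, hξ⟩ := ξ.2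
  obtain ⟨A, k, hA, hg⟩ := hφ.growth
  obtain ⟨C, hC, hexp⟩ := one_add_rpow_le_exp (k * q)
  have hbound : ∀ x : Fin n → ℝ, |φ x| ^ q ≤
      A ^ q * C * (1 + ∑ i, (Real.exp (1 * x i) + Real.exp (-1 * x i))) := fun x => by
    have hx := norm_nonneg x
    calc |φ x| ^ q ≤ (A * (1 + ‖x‖) ^ k) ^ q :=
          Real.rpow_le_rpow (abs_nonneg _) (hg x) hq.le
      _ = A ^ q * (1 + ‖x‖) ^ (k * q) := by
          rw [Real.mul_rpow hA (by positivity), ← Real.rpow_natCast, ← Real.rpow_mul (by positivity)]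
      _ ≤ A ^ q * (C * (1 + ∑ i, (Real.exp (1 * x i) + Real.exp (-1 * x i)))) := by
          grw [hexp _ hx, exp_norm_le x]
      _ = _ := by ring
  set E : ℝ≥0∞ := ENNReal.ofReal (Real.exp (K ^ 2 * T / 2)) with hE
  have hsup : gExp hW Θ (fun x => ‖ξ.1 x‖ₑ ^ q) ≤
      ENNReal.ofReal (A ^ q * C) * (1 + ∑ _i : Fin n, (E + E)) := by
    refine iSup_le fun θ => ?_
    have hm : ∀ (σ : ℝ) (i : Fin n),
        Measurable fun ω => ENNReal.ofReal (Real.exp (σ * (θ.path ω).1 (min (t i) T))) := fun σ i =>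
      (Real.measurable_exp.comp ((θ.measurable_path _).const_mul σ)).ennreal_ofReal
    have hE' : ∀ (σ : ℝ) (i : Fin n), |σ| = 1 →
        ∫⁻ ω, ENNReal.ofReal (Real.exp (σ * (θ.path ω).1 (min (t i) T))) ∂P ≤ E := fun σ i hσ => by
      refine (θ.lintegral_exp_path_le hKpos.le hK _ hσ).trans ?_
      rw [hE]
      gcongr
      exact min_le_right _ _
    calc ∫⁻ ω, ‖ξ.1 (θ.path ω)‖ₑ ^ q ∂P
        ≤ ∫⁻ ω, ENNReal.ofReal (A ^ q * C) *
            (1 + ∑ i, (ENNReal.ofReal (Real.exp (1 * (θ.path ω).1 (min (t i) T))) +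
              ENNReal.ofReal (Real.exp (-1 * (θ.path ω).1 (min (t i) T))))) ∂P := by
          refine lintegral_mono fun ω => ?_
          have h := ENNReal.ofReal_le_ofReal (hbound fun i => (θ.path ω).1 (min (t i) T))
          rw [ENNReal.ofReal_mul (by positivity), ENNReal.ofReal_add zero_le_one
            (Finset.sum_nonneg fun i _ => by positivity), ENNReal.ofReal_one,
            ENNReal.ofReal_sum_of_nonneg fun i _ => by positivity] at h
          simp only [ENNReal.ofReal_add (Real.exp_pos _).le (Real.exp_pos _).le] at h
          refine le_trans (le_of_eq ?_) h
          rw [hξ, Real.enorm_eq_ofReal_abs, ENNReal.ofReal_rpow_of_nonneg (abs_nonneg _) hq.le]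
      _ ≤ _ := by
          rw [lintegral_const_mul' _ _ ENNReal.ofReal_ne_top, lintegral_add_left measurable_const,
            lintegral_finsetSum _ fun i _ => (hm 1 i).fun_add (hm (-1) i)]
          simp_rw [lintegral_add_left (hm 1 _)]
          rw [lintegral_const, measure_univ, mul_one]
          gcongr with i
          · exact hE' 1 i (by simp)
          · exact hE' (-1) i (by simp)
  exact hsup.trans_lt (ENNReal.mul_lt_top ENNReal.ofReal_lt_top
    (by simp [hE, ENNReal.mul_lt_top]))

end Moments


/-! ### Extension of `Φ` and of the product -/

section Product

variable {Ω : Type*} [mΩ : MeasurableSpace Ω] {P : Measure Ω} [P.IsComplete] {W : ℝ≥0 → Ω → ℝ}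
  {hW : IsBrownianReal W P} {Θ : Set ℝ} {T : ℝ≥0} {p : ℝ} {hp : 0 < p}

/-- The pointwise product of two families of random variables. -/
noncomputable def RandomFamily.mul (X Y : RandomFamily hW Θ hp) : RandomFamily hW Θ (half_pos hp) :=
  fun θ => X θ * Y θ

theorem RandomFamily.supMoment_lt_top_of_edist_lt_top {X Y : RandomFamily hW Θ hp}
    (hY : supMoment P p (fun θ => Y θ) < ∞) (h : edist X Y < ∞) :
    supMoment P p (fun θ => X θ) < ∞ := by
  rw [RandomFamily.edist_eq, ENNReal.rpow_lt_top_iff_of_pos (min_one_inv_pos hp)] at h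
  have := supMoment_add_lt_top hp (fun θ => (X.aemeasurable θ).sub (Y.aemeasurable θ))
    Y.aemeasurable h hY
  simpa using this

theorem RandomFamily.tendsto_mul {κ : Type*} {l : Filter κ} {X Y : κ → RandomFamily hW Θ hp}
    {U V : RandomFamily hW Θ hp} (hU : supMoment P p (fun θ => U θ) < ∞)
    (hV : supMoment P p (fun θ => V θ) < ∞) (hX : Tendsto X l (𝓝 U)) (hY : Tendsto Y l (𝓝 V)) :
    Tendsto (fun k => (X k).mul (Y k)) l (𝓝 (U.mul V)) := by
  rw [RandomFamily.tendsto_iff] at hX hY ⊢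
  have := tendsto_supMoment_mul_sub_mul hp (fun k => (X k).aemeasurable)
    (fun k => (Y k).aemeasurable) U.aemeasurable V.aemeasurable hU hV hX hY
  refine this.congr fun k => supMoment_congr fun θ => ?_
  filter_upwards [AEEqFun.coeFn_mul (X k θ) (Y k θ), AEEqFun.coeFn_mul (U θ) (V θ)] with ω h1 h2
  simp only [RandomFamily.mul, h1, h2, Pi.mul_apply]

theorem phiCyl_ae_eq (ξ : cylinderFunctions T) (θ : Control hW Θ) :
    PhiCyl hW Θ hp ξ θ =ᵐ[P] fun ω => ξ.1 (θ.path ω) := AEEqFun.coeFn_mk _ _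

theorem phiCyl_mul (ξ η : cylinderFunctions T) :
    PhiCyl hW Θ (half_pos hp) (ξ * η) = (PhiCyl hW Θ hp ξ).mul (PhiCyl hW Θ hp η) := by
  funext θ
  exact (AEEqFun.mk_mul_mk _ _ (measurable_cylinder ξ θ).aestronglyMeasurable
    (measurable_cylinder η θ).aestronglyMeasurable).symm

theorem supMoment_phiCyl (ξ : cylinderFunctions T) :
    supMoment P p (fun θ => PhiCyl hW Θ hp ξ θ) = gExp hW Θ (fun x => ‖ξ.1 x‖ₑ ^ p) :=
  supMoment_congr (g := fun θ ω => ξ.1 (θ.path ω)) fun θ => phiCyl_ae_eq ξ θ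

/-- Up to the choice of a.e. representatives, both distances are the same supremum of moments.
Continuity and Cauchy properties can therefore be tested after applying `Φ`. -/
theorem isometry_phiCyl :
    Isometry (fun ξ : GCylinder hW Θ T hp => PhiCyl hW Θ hp (show cylinderFunctions T from ξ)) := by
  intro ξ η
  refine congrArg (fun x : ℝ≥0∞ => x ^ (min 1 p⁻¹)) ?_
  refine supMoment_congr (P := P) (p := p) (g := fun (θ : Control hW Θ) ω =>
    (show cylinderFunctions T from ξ).1 (θ.path ω) -
      (show cylinderFunctions T from η).1 (θ.path ω)) fun θ => ?_
  filter_upwards [phiCyl_ae_eq (hp := hp) (show cylinderFunctions T from ξ) θ,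
    phiCyl_ae_eq (hp := hp) (show cylinderFunctions T from η) θ] with ω h1 h2
  simp only [h1, h2]

theorem phi_of (ξ : cylinderFunctions T) : Phi (LG.of hW Θ hp ξ) = PhiCyl hW Θ hp ξ :=
  UniformSpace.Completion.extension_coe isometry_phiCyl.uniformContinuous _

theorem continuous_phi : Continuous (Phi : LG hW Θ T hp → RandomFamily hW Θ hp) :=
  UniformSpace.Completion.continuous_extension

theorem supMoment_phi_lt_top (hΘ : IsCompact Θ) (X : LG hW Θ T hp) :
    supMoment P p (fun θ => Phi X θ) < ∞ := by
  -- This open set contains `X`, so by density it contains a cylinder function, and finite moments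
  -- pass across finite distances.
  have hopen : IsOpen {Y : LG hW Θ T hp | edist (Phi X) (Phi Y) < ∞} :=
    isOpen_lt (continuous_const.edist continuous_phi) continuous_const
  obtain ⟨ξ, hξ⟩ := (UniformSpace.Completion.denseRange_coe
    (α := GCylinder hW Θ T hp)).exists_mem_open hopen ⟨X, by simp⟩
  refine RandomFamily.supMoment_lt_top_of_edist_lt_top ?_ hξ
  have h := gExp_cylinder_lt_top (hW := hW) hΘ hp (show cylinderFunctions T from ξ)
  rwa [← supMoment_phiCyl (hp := hp), ← phi_of] at h

/-- The product of cylinder functions, as an element of `L_G^{p/2}`. -/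
noncomputable def mulCyl (z : GCylinder hW Θ T hp × GCylinder hW Θ T hp) :
    GCylinder hW Θ T (half_pos hp) :=
  (show cylinderFunctions T from z.1) * (show cylinderFunctions T from z.2)

/-- Multiplicativity on cylinder functions combined with continuity of products of families. The
filter is the one along which `LG.mul` is extended, so this yields both the continuity of `mulCyl`
and the existence of its extension. -/
theorem tendsto_phiCyl_mulCyl (hΘ : IsCompact Θ) (X Y : LG hW Θ T hp) :
    Tendsto (fun z : GCylinder hW Θ T hp × GCylinder hW Θ T hp =>
      PhiCyl hW Θ (half_pos hp) (show cylinderFunctions T from mulCyl z))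
      (comap (Prod.map UniformSpace.Completion.coe' UniformSpace.Completion.coe') (𝓝 (X, Y)))
      (𝓝 ((Phi X).mul (Phi Y))) := by
  have h := tendsto_comap (f := Prod.map (UniformSpace.Completion.coe' (α := GCylinder hW Θ T hp))
    (UniformSpace.Completion.coe' (α := GCylinder hW Θ T hp))) (x := 𝓝 (X, Y))
  have h1 := (continuous_phi.tendsto X).comp ((continuous_fst.tendsto (X, Y)).comp h)
  have h2 := (continuous_phi.tendsto Y).comp ((continuous_snd.tendsto (X, Y)).comp h)
  refine (RandomFamily.tendsto_mul (supMoment_phi_lt_top hΘ X) (supMoment_phi_lt_top hΘ Y)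
    h1 h2).congr fun z => ?_
  refine Eq.trans ?_ (phiCyl_mul (hp := hp) (show cylinderFunctions T from z.1)
    (show cylinderFunctions T from z.2)).symm
  exact congrArg₂ RandomFamily.mul (phi_of _) (phi_of _)

theorem continuous_mulCyl (hΘ : IsCompact Θ) :
    Continuous (mulCyl : GCylinder hW Θ T hp × GCylinder hW Θ T hp → _) := by
  rw [isometry_phiCyl.isUniformInducing.isInducing.continuous_iff, continuous_iff_continuousAt]
  rintro ⟨ξ, η⟩
  have hdi := (UniformSpace.Completion.isDenseInducing_coe (α := GCylinder hW Θ T hp)).prodMap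
    (UniformSpace.Completion.isDenseInducing_coe (α := GCylinder hW Θ T hp))
  have h := tendsto_phiCyl_mulCyl hΘ (UniformSpace.Completion.coe' ξ)
    (UniformSpace.Completion.coe' η)
  have hval : (Phi (UniformSpace.Completion.coe' ξ)).mul (Phi (UniformSpace.Completion.coe' η)) =
      PhiCyl hW Θ (half_pos hp) (show cylinderFunctions T from mulCyl (ξ, η)) :=
    (congrArg₂ RandomFamily.mul (phi_of _) (phi_of _)).trans (phiCyl_mul (hp := hp) _ _).symm
  rw [hval] at h
  have hn := hdi.isInducing.nhds_eq_comap (ξ, η)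
  rw [ContinuousAt, hn]
  exact h

/-- After `Φ` the products converge, hence are Cauchy; the isometry reflects this, and the
completion supplies a limit. -/
theorem exists_tendsto_coe_mulCyl (hΘ : IsCompact Θ)
    (Z : LG hW Θ T hp × LG hW Θ T hp) :
    ∃ c : LG hW Θ T (half_pos hp),
      Tendsto (fun z => (UniformSpace.Completion.coe' (mulCyl z) : LG hW Θ T (half_pos hp)))
        (comap (Prod.map UniformSpace.Completion.coe' UniformSpace.Completion.coe') (𝓝 Z))
        (𝓝 c) := by
  have hdi := (UniformSpace.Completion.isDenseInducing_coe (α := GCylinder hW Θ T hp)).prodMap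
    (UniformSpace.Completion.isDenseInducing_coe (α := GCylinder hW Θ T hp))
  have hne := hdi.comap_nhds_neBot Z
  have h := (tendsto_phiCyl_mulCyl hΘ Z.1 Z.2).cauchy_map
  have hc : Cauchy (map (mulCyl (hp := hp)) (comap (Prod.map UniformSpace.Completion.coe'
      UniformSpace.Completion.coe') (𝓝 Z))) :=
    isometry_phiCyl.isUniformInducing.cauchy_map_iff.1 h
  exact cauchy_map_iff_exists_tendsto.1
    (hc.map (UniformSpace.Completion.uniformContinuous_coe _))

theorem continuous_mul (hΘ : IsCompact Θ) :
    Continuous fun Z : LG hW Θ T hp × LG hW Θ T hp => LG.mul Z.1 Z.2 :=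
  IsDenseInducing.continuous_extend _ (exists_tendsto_coe_mulCyl hΘ)

theorem mul_of (hΘ : IsCompact Θ) (ξ η : cylinderFunctions T) :
    LG.mul (LG.of hW Θ hp ξ) (LG.of hW Θ hp η) = LG.of hW Θ (half_pos hp) (ξ * η) :=
  IsDenseInducing.extend_eq
    ((UniformSpace.Completion.isDenseInducing_coe (α := GCylinder hW Θ T hp)).prodMap
      (UniformSpace.Completion.isDenseInducing_coe (α := GCylinder hW Θ T hp)))
    ((UniformSpace.Completion.continuous_coe _).comp (continuous_mulCyl hΘ))
    ((ξ, η) : GCylinder hW Θ T hp × GCylinder hW Θ T hp)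

theorem phi_mul (hΘ : IsCompact Θ) (X Y : LG hW Θ T hp) :
    Phi (LG.mul X Y) = (Phi X).mul (Phi Y) := by
  refine UniformSpace.Completion.induction_on₂ X Y (isClosed_eq
    (continuous_phi.comp (continuous_mul hΘ)) (continuous_iff_continuousAt.2 fun Z => ?_))
    fun ξ η => ?_
  · exact RandomFamily.tendsto_mul (supMoment_phi_lt_top hΘ _) (supMoment_phi_lt_top hΘ _)
      (continuous_phi.comp continuous_fst).continuousAt
      (continuous_phi.comp continuous_snd).continuousAt
  · refine (congrArg Phi (mul_of hΘ (show cylinderFunctions T from ξ)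
      (show cylinderFunctions T from η))).trans ((phi_of _).trans ((phiCyl_mul (hp := hp) _ _).trans ?_))
    exact (congrArg₂ RandomFamily.mul (phi_of _) (phi_of _)).symm

end Product

end GExpectation

/-! ### The theorem -/

open GExpectation in
theorem mainTheorem1 {Ω : Type*} [MeasurableSpace Ω] {P : Measure Ω} [IsProbabilityMeasure P]
    [P.IsComplete] {W : ℝ≥0 → Ω → ℝ} (hW : IsBrownianReal W P) {Θ : Set ℝ} (hΘ : IsCompact Θ)
    (hΘ' : Convex ℝ Θ) (T : ℝ≥0) {p : ℝ} (hp : 0 < p) :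
    -- `Φ` is well defined: for every exponent `q`, cylinder functions have finite `L_G^q`-norm, `Φ`
    -- extends substitution of `B^θ`, is continuous, and takes values in the families bounded in
    -- `L^q(P)` uniformly in `θ`
    (∀ (q : ℝ) (hq : 0 < q),
      (∀ ξ : cylinderFunctions T, gExp hW Θ (fun x => ‖ξ.1 x‖ₑ ^ q) < ∞) ∧
      (∀ ξ : cylinderFunctions T, Phi (LG.of hW Θ hq ξ) = PhiCyl hW Θ hq ξ) ∧
      Continuous (Phi : LG hW Θ T hq → RandomFamily hW Θ hq) ∧
      ∀ X : LG hW Θ T hq, (⨆ θ : Control hW Θ, ∫⁻ ω, ‖Phi X θ ω‖ₑ ^ q ∂P) < ∞) ∧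
    -- the product `L_G^p × L_G^p → L_G^{p/2}` is well defined
    ((∀ ξ η : cylinderFunctions T,
        LG.mul (LG.of hW Θ hp ξ) (LG.of hW Θ hp η) = LG.of hW Θ (half_pos hp) (ξ * η)) ∧
      Continuous fun Z : LG hW Θ T hp × LG hW Θ T hp => LG.mul Z.1 Z.2) ∧
    -- `Φ(X · Y) = Φ(X) · Φ(Y)`
    (∀ X Y : LG hW Θ T hp, ∀ θ : Control hW Θ, Phi (LG.mul X Y) θ = Phi X θ * Phi Y θ) ∧
    -- products of approximating cylinder functions converge, in `L_G^{p/2}` and, after applying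
    -- `Φ`, in `L^{p/2}(P)` uniformly in `θ`
    (∀ (X Y : LG hW Θ T hp) (ξ η : ℕ → cylinderFunctions T),
      Tendsto (fun n => LG.of hW Θ hp (ξ n)) atTop (𝓝 X) →
      Tendsto (fun n => LG.of hW Θ hp (η n)) atTop (𝓝 Y) →
      Tendsto (fun n => LG.of hW Θ (half_pos hp) (ξ n * η n)) atTop (𝓝 (LG.mul X Y)) ∧
      Tendsto (fun n => ⨆ θ : Control hW Θ, ∫⁻ ω,
        ‖(ξ n).1 (θ.path ω) * (η n).1 (θ.path ω) - Phi X θ ω * Phi Y θ ω‖ₑ ^ (p / 2) ∂P)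
        atTop (𝓝 0)) := by
  refine ⟨fun q hq => ⟨gExp_cylinder_lt_top hΘ hq, phi_of, continuous_phi,
    supMoment_phi_lt_top hΘ⟩, ⟨mul_of hΘ, continuous_mul hΘ⟩,
    fun X Y θ => congrFun (phi_mul hΘ X Y) θ, fun X Y ξ η hξ hη => ?_⟩
  have hmul : Tendsto (fun n => LG.of hW Θ (half_pos hp) (ξ n * η n)) atTop (𝓝 (LG.mul X Y)) :=
    (((continuous_mul hΘ).tendsto (X, Y)).comp (hξ.prodMk_nhds hη)).congr
      fun n => mul_of hΘ (ξ n) (η n)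
  refine ⟨hmul, ?_⟩
  -- The uniform convergence in `L^{p/2}(P)` is the image under `Φ` of the convergence in
  -- `L_G^{p/2}`, rewritten with a.e. representatives.
  have h := (continuous_phi.tendsto _).comp hmul
  rw [phi_mul hΘ, RandomFamily.tendsto_iff] at h
  refine h.congr fun n => supMoment_congr (g := fun (θ : Control hW Θ) ω =>
    (ξ n).1 (θ.path ω) * (η n).1 (θ.path ω) - Phi X θ ω * Phi Y θ ω) fun θ => ?_
  have h1 : Phi (LG.of hW Θ (half_pos hp) (ξ n * η n)) θ =ᵐ[P]
      fun ω => (ξ n * η n).1 (θ.path ω) := by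
    rw [phi_of]
    exact phiCyl_ae_eq _ _
  filter_upwards [h1, AEEqFun.coeFn_mul (Phi X θ) (Phi Y θ)] with ω h1 h2
  simp only [Function.comp_apply, RandomFamily.mul, h1, h2, Pi.mul_apply]
  rfl
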